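/- Let $\mathrm{H}_3(\mathbb{Q})$ be the Heisenberg group of all matrices $\begin{pmatrix}1&a&c\\0&1&b\\0&0&1\end{pmatrix}$ with $a,b,c\in\mathbb{Q}$, under matrix multiplication. For a subset $\mathcal{G}$ of $\mathrm{H}_3(\mathbb{Q})$ let $\langle\mathcal{G}\rangle$ denote the semigroup generated by $\mathcal{G}$, that is, the set of all products of non-empty finite sequences of elements of $\mathcal{G}$, and for $T\in\mathrm{H}_3(\mathbb{Q})$ let $T\cdot\langle\mathcal{G}\rangle=\{T\cdot s\mid s\in\langle\mathcal{G}\rangle\}$. Then the following problem is decidable: given elements $T,S\in\mathrm{H}_3(\mathbb{Q})$ and two finite subsets $\mathcal{G},\mathcal{H}$ of $\mathrm{H}_3(\mathbb{Q})$ (rational entries being given as fractions of integers, finite sets as lists of their elements), decide whether $T\cdot\langle\mathcal{G}\rangle\cap S\cdot\langle\mathcal{H}\rangle=\emptyset$. That is, there is one algorithm that halts on every such input and answers correctly. -/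

import Mathlib

/-- The Heisenberg group `H₃(R)`: the group of all `3 × 3` matrices
`(1 a c; 0 1 b; 0 0 1)` with `a b c : R`, under matrix multiplication. -/
def Heisenberg3 (R : Type*) [CommRing R] : Subgroup (Matrix.SpecialLinearGroup (Fin 3) R) where
  carrier := {A | ∃ a b c : R,
    (A : Matrix (Fin 3) (Fin 3) R) = !![1, a, c; 0, 1, b; 0, 0, 1]}
  one_mem' := ⟨0, 0, 0, by
    ext i j; fin_cases i <;> fin_cases j <;> simp⟩
  mul_mem' := by
    rintro A B ⟨a, b, c, hA⟩ ⟨a', b', c', hB⟩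
    refine ⟨a + a', b + b', c' + a * b' + c, ?_⟩
    rw [Matrix.SpecialLinearGroup.coe_mul, hA, hB]
    ext i j; fin_cases i <;> fin_cases j <;> simp [Matrix.mul_apply, Fin.sum_univ_three, add_comm]
  inv_mem' := by
    rintro A ⟨a, b, c, hA⟩
    refine ⟨-a, -b, a * b - c, ?_⟩
    rw [Matrix.SpecialLinearGroup.coe_inv, hA, Matrix.adjugate_fin_three]
    ext i j; fin_cases i <;> fin_cases j <;> simp

/-- The orbit `T · ⟨𝒢⟩ = {T · s | s ∈ ⟨𝒢⟩}`, where `⟨𝒢⟩` is the semigroup generated by `𝒢`,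
i.e. the set of all products of non-empty words over `𝒢`. -/
def semigroupOrbit {G : Type*} [Group G] (T : G) (𝒢 : Set G) : Set G :=
  {x | ∃ s ∈ Subsemigroup.closure 𝒢, x = T * s}

/-- A pair (numerator, denominator). -/
abbrev RatCode : Type := ℤ × ℕ

/-- `(p, d)` is a code of the rational number `q` if `d ≠ 0` and `q = p / d`
(the fraction need not be reduced). -/
def RatCode.Encodes (x : RatCode) (q : ℚ) : Prop :=
  x.2 ≠ 0 ∧ q = (x.1 : ℚ) / (x.2 : ℚ)

/-- Codes of the three entries `a`, `b`, `c` of a matrix `(1 a c; 0 1 b; 0 0 1)`. -/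
abbrev HeisenbergCode : Type := RatCode × RatCode × RatCode

/-- The code `x` lists the entries `(1, 2)`, `(2, 3)` and `(1, 3)` of `A`. -/
def HeisenbergCode.Encodes (x : HeisenbergCode) (A : Heisenberg3 ℚ) : Prop :=
  ∃ a b c : ℚ, x.1.Encodes a ∧ x.2.1.Encodes b ∧ x.2.2.Encodes c ∧
    (A.1 : Matrix (Fin 3) (Fin 3) ℚ) = !![1, a, c; 0, 1, b; 0, 0, 1]

/-- The list `l` enumerates codes of exactly the elements of the finite set `𝒢`
(in any order, repetitions allowed). -/
def EncodesFinset (l : List HeisenbergCode) (𝒢 : Finset (Heisenberg3 ℚ)) : Prop :=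
  (∀ x ∈ l, ∃ A ∈ 𝒢, x.Encodes A) ∧ (∀ A ∈ 𝒢, ∃ x ∈ l, HeisenbergCode.Encodes x A)

/-- Every element of `H₃(ℚ)` has a code. -/
theorem HeisenbergCode.exists_encodes (A : Heisenberg3 ℚ) :
    ∃ x : HeisenbergCode, x.Encodes A := by
  obtain ⟨a, b, c, h⟩ := A.2
  exact ⟨((a.num, a.den), (b.num, b.den), (c.num, c.den)), a, b, c,
    ⟨a.den_nz, (Rat.num_div_den a).symm⟩, ⟨b.den_nz, (Rat.num_div_den b).symm⟩,
    ⟨c.den_nz, (Rat.num_div_den c).symm⟩, h⟩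

/-- Every finite subset of `H₃(ℚ)` has a code. -/
theorem exists_encodesFinset (𝒢 : Finset (Heisenberg3 ℚ)) :
    ∃ l : List HeisenbergCode, EncodesFinset l 𝒢 := by
  choose f hf using HeisenbergCode.exists_encodes
  refine ⟨𝒢.toList.map f, fun x hx => ?_, fun A hA => ?_⟩
  · obtain ⟨A, hA, rfl⟩ := List.mem_map.1 hx
    exact ⟨A, Finset.mem_toList.1 hA, hf A⟩
  · exact ⟨f A, List.mem_map.2 ⟨A, Finset.mem_toList.2 hA, rfl⟩, hf A⟩

/-!
# Decidability of orbit intersection in the Heisenberg group over `ℚ`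

The dilation `(a, b, c) ↦ (d a, d b, d² c)` by a common denominator `d` moves all data into an
integral Heisenberg group, written in the symmetric coordinates `z = 2 c - a b` (`SymHeis`), so that
a product has central coordinate `∑ zᵢ + ∑_{i < j} ω(gᵢ, gⱼ)` with `ω` the symplectic form on the
abelianisation `ℤ²`. The theorem follows from a small-solution property: if `T w = v` has a solution
in words `w` over `G` and `v` over `H`, then it has one whose length is bounded by a primitive
recursive function of the largest entry (`SymHeis.exists_short_solution`). The algorithm enumerates
all words up to that length.

The combinatorial tool is a Steinitz-type argument (`exists_small_balanced`): a true equation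
`s + ∑_A f = ∑_B g` between bounded vectors of `ℤ^d` remains true for suitable `A' ⊆ A`, `B' ⊆ B` of
bounded size. Call a letter of `G` recurrent if it occurs in a word over `G` with the same
abelianisation as some word over `H`, and symmetrically for `H`.

* Suppose two recurrent letters `i, j` of `G` have `δ = ω(i, j) ≠ 0`. Removing factors that are
  trivial in the finite quotient modulo `2 δ`, and putting back a balanced selection of them, yields
  short words solving the equation exactly in the abelianisation and modulo `2 δ` in the centre
  (`SymHeis.exists_short_congruent`). The error is a multiple of `2 δ`. Append words over `G` and `H`
  of equal abelianisation that contain `k` times the letters `i` and `j`: reordering these changes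
  the central coordinate by any multiple of `2 δ` in a range quadratic in `k`, whereas the words
  otherwise contribute only linearly in `k`. So the error can be cancelled with `k` bounded
  (`SymHeis.exists_central_shift`). The case of two letters of `H` is symmetric, by
  `T⁻¹ v = w`.
* Otherwise recurrent letters of `G` commute, as do those of `H`. In any solution only boundedly many
  letters are not recurrent (`SymHeis.length_filter_not_recurrent_le`). With these held fixed, the
  value of a word is a sum of bounded vectors of `ℤ³`, one for each occurrence of a recurrent letter
  (`SymHeis.exists_linearisation`), so a balanced selection in `ℤ³` gives a short solution.
-/

/-! ### Zero-sum blocks of bounded size -/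

/-- A zero-sum multiset of integers of absolute value at most `M` can be enumerated so that every
partial sum, started at `c`, stays in `[-M, M]`: at each step an element is chosen whose sign is
opposite to that of the current partial sum. -/
theorem exists_list_partial_sums_bounded {ι : Type*} (f : ι → ℤ) (M : ℕ) (S : Multiset ι)
    (hM : ∀ x ∈ S, |f x| ≤ M) (c : ℤ) (hc : |c| ≤ M) (hS : c + (S.map f).sum = 0) :
    ∃ l : List ι, (l : Multiset ι) = S ∧ ∀ n, |c + ((l.take n).map f).sum| ≤ M := by
  classical
  induction hn : S.card generalizing S c with
  | zero =>
    obtain rfl := Multiset.card_eq_zero.1 hn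
    exact ⟨[], rfl, by simpa using hc⟩
  | succ k ih =>
    obtain ⟨x, hx, hx'⟩ : ∃ x ∈ S, |c + f x| ≤ M := by
      rcases lt_or_ge 0 c with h0 | h0
      · obtain ⟨x, hx, hlt⟩ : ∃ x ∈ S, f x < 0 := by
          by_contra! h
          have := Multiset.sum_nonneg (s := S.map f) (by simpa using h)
          omega
        refine ⟨x, hx, ?_⟩
        have := hM x hx
        rw [abs_le] at *
        omega
      · obtain ⟨x, hx, hlt⟩ : ∃ x ∈ S, 0 ≤ f x := by
          by_contra! h
          obtain ⟨y, hy⟩ := Multiset.card_pos_iff_exists_mem.1 (by omega : 0 < S.card)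
          obtain ⟨S', rfl⟩ := Multiset.exists_cons_of_mem hy
          have h1 := h y hy
          have := Multiset.sum_nonneg (s := S'.map (fun x => - f x)) (by
            intro z hz
            obtain ⟨w, hw, rfl⟩ := Multiset.mem_map.1 hz
            have := h w (Multiset.mem_cons_of_mem hw)
            omega)
          rw [Multiset.sum_map_neg] at this
          rw [Multiset.map_cons, Multiset.sum_cons] at hS
          omega
        refine ⟨x, hx, ?_⟩
        have := hM x hx
        rw [abs_le] at *
        omega
    obtain ⟨S', rfl⟩ := Multiset.exists_cons_of_mem hx
    obtain ⟨l, hl, hl'⟩ := ih S' (fun y hy => hM y (Multiset.mem_cons_of_mem hy)) (c + f x) hx'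
      (by rw [Multiset.map_cons, Multiset.sum_cons] at hS; linarith)
      (by simpa using hn)
    refine ⟨x :: l, by rw [← hl]; rfl, fun n => ?_⟩
    cases n with
    | zero => simpa using hc
    | succ n => simpa [add_assoc] using hl' n

/-- A nonempty zero-sum multiset of integers of absolute value at most `M` has a nonempty zero-sum
sub-multiset with at most `2 * M + 1` elements. -/
theorem exists_small_zero_sum {ι : Type*} (f : ι → ℤ) (M : ℕ) (S : Multiset ι)
    (hM : ∀ x ∈ S, |f x| ≤ M) (h0 : S ≠ 0) (hS : (S.map f).sum = 0) :
    ∃ t ≤ S, t ≠ 0 ∧ t.card ≤ 2 * M + 1 ∧ (t.map f).sum = 0 := by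
  classical
  rcases le_or_gt S.card (2 * M + 1) with hk | hk
  · exact ⟨S, le_rfl, h0, hk, hS⟩
  obtain ⟨l, rfl, hl'⟩ := exists_list_partial_sums_bounded f M S hM 0 (by simp) (by simpa using hS)
  -- Among the `2 * M + 2` first partial sums, all in `[-M, M]`, two coincide.
  obtain ⟨i, hi, j, hj, hij, he⟩ := Finset.exists_ne_map_eq_of_card_lt_of_maps_to
    (s := Finset.range (2 * M + 2)) (t := Finset.Icc (-(M : ℤ)) M)
    (f := fun n => ((l.take n).map f).sum) (by simp; omega) (by
      intro n _
      have := hl' n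
      rw [abs_le, zero_add] at this
      simpa using this)
  wlog hlt : i < j generalizing i j
  · exact this j hj i hi hij.symm he.symm (by omega)
  simp only [Finset.mem_range] at hi hj
  simp only [Multiset.coe_card] at hk
  have hsub : ((l.take j).drop i).length = j - i := by
    rw [List.length_drop, List.length_take]; omega
  refine ⟨((l.take j).drop i : List ι), ?_, ?_, ?_, ?_⟩
  · exact ((List.drop_sublist _ _).trans (List.take_sublist _ _)).subperm
  · rw [Ne, ← Multiset.card_eq_zero, Multiset.coe_card]; omega
  · rw [Multiset.coe_card]; omega
  · have h1 : (l.take j) = l.take i ++ (l.take j).drop i := by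
      conv_lhs => rw [← List.take_append_drop i (l.take j)]
      rw [List.take_take, min_eq_left hlt.le]
    rw [h1, List.map_append, List.sum_append] at he
    rw [Multiset.map_coe, Multiset.sum_coe]
    linarith

/-- A zero-sum multiset of integers splits into nonempty zero-sum blocks of bounded size. -/
theorem exists_zero_sum_partition {ι : Type*} (f : ι → ℤ) (M : ℕ) (S : Multiset ι)
    (hM : ∀ x ∈ S, |f x| ≤ M) (hS : (S.map f).sum = 0) :
    ∃ L : Multiset (Multiset ι), L.join = S ∧
      ∀ t ∈ L, t ≠ 0 ∧ t.card ≤ 2 * M + 1 ∧ (t.map f).sum = 0 := by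
  classical
  induction hn : S.card using Nat.strong_induction_on generalizing S with
  | _ n ih =>
    by_cases h0 : S = 0
    · exact ⟨0, by simp [h0], by simp⟩
    obtain ⟨t, ht, ht0, htc, hts⟩ := exists_small_zero_sum f M S hM h0 hS
    obtain ⟨R, rfl⟩ := Multiset.le_iff_exists_add.1 ht
    have hpos := Multiset.card_pos.2 ht0
    rw [Multiset.card_add] at hn
    rw [Multiset.map_add, Multiset.sum_add, hts, zero_add] at hS
    obtain ⟨L, hL, hL'⟩ := ih R.card (by omega) R
      (fun x hx => hM x (Multiset.mem_add.2 (Or.inr hx))) hS rfl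
    refine ⟨t ::ₘ L, by rw [Multiset.join_cons, hL], fun u hu => ?_⟩
    rcases Multiset.mem_cons.1 hu with rfl | hu
    exacts [⟨ht0, htc, hts⟩, hL' u hu]

theorem abs_multiset_sum_le {ι : Type*} (f : ι → ℤ) (M : ℤ) (S : Multiset ι)
    (hM : ∀ x ∈ S, |f x| ≤ M) : |(S.map f).sum| ≤ S.card * M := by
  induction S using Multiset.induction_on with
  | empty => simp
  | cons x S ih =>
    rw [Multiset.map_cons, Multiset.sum_cons, Multiset.card_cons]
    have h1 := hM x (Multiset.mem_cons_self x S)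
    have h2 := ih fun y hy => hM y (Multiset.mem_cons_of_mem hy)
    have h3 := abs_add_le (f x) (S.map f).sum
    push_cast
    linarith

theorem Multiset.card_join_le {ι : Type*} (L : Multiset (Multiset ι)) (K : ℕ)
    (h : ∀ t ∈ L, t.card ≤ K) : L.join.card ≤ L.card * K := by
  rw [Multiset.card_join]
  simpa using Multiset.sum_le_card_nsmul (L.map Multiset.card) K (by simpa using h)

theorem Multiset.sum_map_join_eq {ι : Type*} (L : Multiset (Multiset ι)) (f : ι → ℤ) :
    (L.join.map f).sum = (L.map fun t => (t.map f).sum).sum := by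
  simp [Multiset.map_join]

theorem Multiset.exists_le_map_eq {α β : Type*} {f : α → β} {S : Multiset α} {t : Multiset β}
    (h : t ≤ S.map f) : ∃ S' ≤ S, S'.map f = t := by
  induction S using Quotient.inductionOn with | _ l
  induction t using Quotient.inductionOn with | _ k
  obtain ⟨k', hk, hsub⟩ : List.Subperm k (l.map f) := h
  obtain ⟨l', hl', rfl⟩ := List.sublist_map_iff.1 hsub
  exact ⟨l', hl'.subperm, Quotient.sound hk⟩

theorem Multiset.join_mono {ι : Type*} {L L' : Multiset (Multiset ι)} (h : L ≤ L') :
    L.join ≤ L'.join := by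
  obtain ⟨R, rfl⟩ := Multiset.le_iff_exists_add.1 h
  simp

theorem Multiset.join_ne_zero {ι : Type*} {L : Multiset (Multiset ι)} (h0 : L ≠ 0)
    (h : ∀ t ∈ L, t ≠ 0) : L.join ≠ 0 := by
  obtain ⟨t, ht⟩ := Multiset.exists_mem_of_ne_zero h0
  obtain ⟨x, hx⟩ := Multiset.exists_mem_of_ne_zero (h t ht)
  exact fun h1 => by simpa [h1] using Multiset.mem_join.2 ⟨t, ht, hx⟩

/-- The size of zero-sum blocks in dimension `d`: each coordinate multiplies the block size by
`2 * M + 1`, and the entries of the remaining coordinates by the same factor. -/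
def blockBound : ℕ → ℕ → ℕ
  | 0, _ => 1
  | d + 1, M => blockBound d ((2 * M + 1) * M) * (2 * M + 1)

/-- A nonempty zero-sum multiset of vectors in `ℤ^d` with entries bounded by `M` has a nonempty
zero-sum sub-multiset whose size is bounded in terms of `d` and `M`. -/
theorem exists_small_zero_sum_pi (d : ℕ) : ∀ {ι : Type*} (f : ι → Fin d → ℤ) (M : ℕ)
    (S : Multiset ι), (∀ x ∈ S, ∀ i, |f x i| ≤ M) → S ≠ 0 → (∀ i, (S.map (f · i)).sum = 0) →
    ∃ t ≤ S, t ≠ 0 ∧ t.card ≤ blockBound d M ∧ ∀ i, (t.map (f · i)).sum = 0 := by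
  induction d with
  | zero =>
    intro ι f M S _ h0 _
    obtain ⟨x, hx⟩ := Multiset.exists_mem_of_ne_zero h0
    exact ⟨{x}, Multiset.singleton_le.2 hx, by simp, by simp [blockBound], fun i => i.elim0⟩
  | succ d ih =>
    intro ι f M S hM h0 hS
    obtain ⟨L, rfl, hL⟩ := exists_zero_sum_partition (f · 0) M S (fun x hx => hM x hx 0) (hS 0)
    have hb : ∀ t ∈ L, ∀ i : Fin d,
        |(t.map (f · i.succ)).sum| ≤ (((2 * M + 1) * M : ℕ) : ℤ) := by
      intro t ht i
      refine (abs_multiset_sum_le (f · i.succ) M t fun x hx =>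
        hM x (Multiset.mem_join.2 ⟨t, ht, hx⟩) i.succ).trans ?_
      have : (t.card : ℤ) ≤ ((2 * M + 1 : ℕ) : ℤ) := by exact_mod_cast (hL t ht).2.1
      push_cast at this ⊢
      gcongr
    obtain ⟨L', hL', h0', hc, hs⟩ := ih (fun (t : Multiset ι) (i : Fin d) =>
      (t.map (f · i.succ)).sum) ((2 * M + 1) * M) L hb (by rintro rfl; exact h0 rfl)
      (fun i => by rw [← Multiset.sum_map_join_eq]; exact hS i.succ)
    have hmem := fun t (ht : t ∈ L') => hL t (Multiset.mem_of_le hL' ht)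
    refine ⟨L'.join, Multiset.join_mono hL', Multiset.join_ne_zero h0' fun t ht => (hmem t ht).1,
      ?_, ?_⟩
    · exact (Multiset.card_join_le L' (2 * M + 1) fun t ht => (hmem t ht).2.1).trans
        (Nat.mul_le_mul_right _ hc)
    · refine Fin.cases ?_ fun i => ?_
      · rw [Multiset.sum_map_join_eq]
        refine Multiset.sum_eq_zero fun y hy => ?_
        obtain ⟨t, ht, rfl⟩ := Multiset.mem_map.1 hy
        exact (hmem t ht).2.2
      · rw [Multiset.sum_map_join_eq]; exact hs i

/-- The zero-sum block can be chosen to contain a prescribed element: remove blocks avoiding it. -/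
theorem exists_small_zero_sum_mem {d : ℕ} {ι : Type*} (f : ι → Fin d → ℤ) (M : ℕ)
    (s : ι) (S : Multiset ι) (hs : s ∈ S) (hM : ∀ x ∈ S, ∀ i, |f x i| ≤ M)
    (hS : ∀ i, (S.map (f · i)).sum = 0) :
    ∃ t ≤ S, s ∈ t ∧ t.card ≤ blockBound d M ∧ ∀ i, (t.map (f · i)).sum = 0 := by
  induction hn : S.card using Nat.strong_induction_on generalizing S with
  | _ n ih =>
    obtain ⟨t, ht, ht0, htc, hts⟩ := exists_small_zero_sum_pi d f M S hM
      (by rintro rfl; simp at hs) hS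
    by_cases hst : s ∈ t
    · exact ⟨t, ht, hst, htc, hts⟩
    obtain ⟨R, rfl⟩ := Multiset.le_iff_exists_add.1 ht
    have hpos := Multiset.card_pos.2 ht0
    rw [Multiset.card_add] at hn
    obtain ⟨u, hu, h1, h2, h3⟩ := ih R.card (by omega) R
      ((Multiset.mem_add.1 hs).resolve_left hst)
      (fun x hx => hM x (Multiset.mem_add.2 (Or.inr hx)))
      (fun i => by simpa [hts i] using hS i) rfl
    exact ⟨u, hu.trans (Multiset.le_add_left _ _), h1, h2, h3⟩

/-- A balanced equation `s + ∑_A f = ∑_B g` between vectors with entries bounded by `M`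
remains true for sub-multisets of `A` and `B` of bounded total size. -/
theorem exists_small_balanced {d : ℕ} {α β : Type*} (f : α → Fin d → ℤ) (g : β → Fin d → ℤ)
    (M : ℕ) (s : Fin d → ℤ) (A : Multiset α) (B : Multiset β) (hs : ∀ i, |s i| ≤ M)
    (hA : ∀ x ∈ A, ∀ i, |f x i| ≤ M) (hB : ∀ x ∈ B, ∀ i, |g x i| ≤ M)
    (h : ∀ i, s i + (A.map (f · i)).sum = (B.map (g · i)).sum) :
    ∃ A' ≤ A, ∃ B' ≤ B, (∀ i, s i + (A'.map (f · i)).sum = (B'.map (g · i)).sum) ∧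
      A'.card + B'.card ≤ blockBound d M := by
  classical
  set F : Option (α ⊕ β) → Fin d → ℤ :=
    fun x i => x.elim (s i) (Sum.elim (f · i) (- g · i)) with hF
  obtain ⟨t, ht, hst, htc, hts⟩ := exists_small_zero_sum_mem F M none
    (none ::ₘ (A.map (some ∘ Sum.inl) + B.map (some ∘ Sum.inr))) (by simp)
    (by
      intro x hx i
      simp only [Multiset.mem_cons, Multiset.mem_add, Multiset.mem_map] at hx
      rcases hx with rfl | ⟨a, ha, rfl⟩ | ⟨b, hb, rfl⟩
      · exact hs i
      · exact hA a ha i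
      · simpa [hF] using hB b hb i)
    (by
      intro i
      have := h i
      simp only [hF, Multiset.map_cons, Multiset.map_add, Multiset.map_map, Multiset.sum_cons,
        Multiset.sum_add, Function.comp_def, Option.elim, Sum.elim_inl, Sum.elim_inr,
        Multiset.sum_map_neg]
      linarith)
  obtain ⟨u, rfl⟩ := Multiset.exists_cons_of_mem hst
  rw [Multiset.cons_le_cons_iff] at ht
  obtain ⟨u₁, u₂, h₁, h₂, rfl⟩ : ∃ u₁ u₂, u₁ ≤ A.map (some ∘ Sum.inl) ∧
      u₂ ≤ B.map (some ∘ Sum.inr) ∧ u = u₁ + u₂ :=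
    ⟨u ∩ A.map (some ∘ Sum.inl), u - A.map (some ∘ Sum.inl), Multiset.inter_le_right,
      tsub_le_iff_left.2 ht, by
        rw [add_comm, Multiset.sub_add_inter]⟩
  obtain ⟨A', hA', rfl⟩ := Multiset.exists_le_map_eq h₁
  obtain ⟨B', hB', rfl⟩ := Multiset.exists_le_map_eq h₂
  refine ⟨A', hA', B', hB', fun i => ?_, ?_⟩
  · have := hts i
    simp only [hF, Multiset.map_cons, Multiset.map_add, Multiset.map_map, Multiset.sum_cons,
      Multiset.sum_add, Function.comp_def, Option.elim, Sum.elim_inl, Sum.elim_inr,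
      Multiset.sum_map_neg] at this
    linarith
  · simp only [Multiset.card_cons, Multiset.card_add, Multiset.card_map] at htc
    omega

theorem blockBound_three (M : ℕ) : blockBound 3 M =
    (2 * ((2 * ((2 * M + 1) * M) + 1) * ((2 * M + 1) * M)) + 1) * (2 * ((2 * M + 1) * M) + 1) *
      (2 * M + 1) := by
  simp [blockBound]

attribute [irreducible] blockBound

/-! ### The integral Heisenberg group -/

/-- The integral Heisenberg group in symmetric coordinates: the triple `(a, b, z)` multiplies by
`(a, b, z) (a', b', z') = (a + a', b + b', z + z' + (a b' - b a'))`. The matrix with entries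
`a, b, c` corresponds to the triple `(a, b, 2 c - a b)`. -/
@[ext]
structure SymHeis where
  a : ℤ
  b : ℤ
  z : ℤ

namespace SymHeis

/-- The symplectic form on the abelianisation, i.e. the commutator pairing (up to a factor `2`). -/
def omega (x y : SymHeis) : ℤ := x.a * y.b - x.b * y.a

instance : Mul SymHeis := ⟨fun x y => ⟨x.a + y.a, x.b + y.b, x.z + y.z + omega x y⟩⟩
instance : One SymHeis := ⟨⟨0, 0, 0⟩⟩
instance : Inv SymHeis := ⟨fun x => ⟨-x.a, -x.b, -x.z⟩⟩

@[simp] theorem one_a : (1 : SymHeis).a = 0 := rfl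
@[simp] theorem one_b : (1 : SymHeis).b = 0 := rfl
@[simp] theorem one_z : (1 : SymHeis).z = 0 := rfl
@[simp] theorem inv_a (x : SymHeis) : x⁻¹.a = -x.a := rfl
@[simp] theorem inv_b (x : SymHeis) : x⁻¹.b = -x.b := rfl
@[simp] theorem inv_z (x : SymHeis) : x⁻¹.z = -x.z := rfl
@[simp] theorem mul_a (x y : SymHeis) : (x * y).a = x.a + y.a := rfl
@[simp] theorem mul_b (x y : SymHeis) : (x * y).b = x.b + y.b := rfl
@[simp] theorem mul_z (x y : SymHeis) :
    (x * y).z = x.z + y.z + (x.a * y.b - x.b * y.a) := rfl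

instance : Group SymHeis :=
  Group.ofLeftAxioms
    (fun x y w => by ext <;> simp <;> ring)
    (fun x => by ext <;> simp)
    (fun x => by ext <;> simp; ring)

@[simp] theorem pow_a (x : SymHeis) (n : ℕ) : (x ^ n).a = n * x.a := by
  induction n with
  | zero => simp
  | succ n ih => rw [pow_succ, mul_a, ih]; push_cast; ring

@[simp] theorem pow_b (x : SymHeis) (n : ℕ) : (x ^ n).b = n * x.b := by
  induction n with
  | zero => simp
  | succ n ih => rw [pow_succ, mul_b, ih]; push_cast; ring

@[simp] theorem pow_z (x : SymHeis) (n : ℕ) : (x ^ n).z = n * x.z := by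
  induction n with
  | zero => simp
  | succ n ih => rw [pow_succ, mul_z, ih, pow_a, pow_b]; push_cast; ring

theorem prod_a (w : List SymHeis) : w.prod.a = (w.map a).sum := by
  induction w with
  | nil => simp
  | cons x w ih => simp [ih]

theorem prod_b (w : List SymHeis) : w.prod.b = (w.map b).sum := by
  induction w with
  | nil => simp
  | cons x w ih => simp [ih]

/-- All three coordinates are at most `M` in absolute value. -/
def Bdd (M : ℕ) (x : SymHeis) : Prop := |x.a| ≤ M ∧ |x.b| ≤ M ∧ |x.z| ≤ M

theorem abs_omega_le {x y : SymHeis} {R M : ℤ} (hxa : |x.a| ≤ R) (hxb : |x.b| ≤ R)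
    (hya : |y.a| ≤ M) (hyb : |y.b| ≤ M) : |omega x y| ≤ 2 * R * M := by
  have hR : 0 ≤ R := (abs_nonneg _).trans hxa
  have h1 : |x.a * y.b| ≤ R * M := by rw [abs_mul]; gcongr
  have h2 : |x.b * y.a| ≤ R * M := by rw [abs_mul]; gcongr
  have := abs_sub (x.a * y.b) (x.b * y.a)
  rw [omega]
  linarith

/-- Bound for the central coordinate of a product of `n` elements with entries at most `M`. -/
def centralBound (M n : ℕ) : ℕ := n * M + 2 * n ^ 2 * M ^ 2

theorem centralBound_mono (M : ℕ) : Monotone (centralBound M) := fun m n h => by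
  unfold centralBound; gcongr

theorem abs_prod_le {M : ℕ} {w : List SymHeis} (h : ∀ x ∈ w, x.Bdd M) :
    |w.prod.a| ≤ w.length * M ∧ |w.prod.b| ≤ w.length * M ∧
      |w.prod.z| ≤ centralBound M w.length := by
  induction w with
  | nil => simp [centralBound]
  | cons x w ih =>
    obtain ⟨h1, h2, h3⟩ := ih fun y hy => h y (List.mem_cons_of_mem _ hy)
    obtain ⟨k1, k2, k3⟩ := h x List.mem_cons_self
    have h4 := abs_omega_le k1 k2 h1 h2
    rw [List.prod_cons, mul_a, mul_b, mul_z, List.length_cons]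
    refine ⟨?_, ?_, ?_⟩
    · have := abs_add_le x.a w.prod.a
      push_cast
      linarith
    · have := abs_add_le x.b w.prod.b
      push_cast
      linarith
    · change |x.z + w.prod.z + omega x w.prod| ≤ _
      have := abs_add_three x.z w.prod.z (omega x w.prod)
      unfold centralBound at h3 ⊢
      push_cast at h3 ⊢
      have : (0 : ℤ) ≤ w.length * M ^ 2 := by positivity
      have : (0 : ℤ) ≤ (M : ℤ) ^ 2 := by positivity
      nlinarith

theorem Bdd.mono {M N : ℕ} {x : SymHeis} (h : x.Bdd M) (hMN : M ≤ N) : x.Bdd N := by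
  have : (M : ℤ) ≤ N := by exact_mod_cast hMN
  exact ⟨h.1.trans this, h.2.1.trans this, h.2.2.trans this⟩

theorem Bdd.inv {M : ℕ} {x : SymHeis} (h : x.Bdd M) : x⁻¹.Bdd M := by
  simpa [Bdd] using h

theorem Bdd.mul {M : ℕ} {x y : SymHeis} (hx : x.Bdd M) (hy : y.Bdd M) :
    (x * y).Bdd (2 * M + 2 * M ^ 2) := by
  have h1 := abs_add_le x.a y.a
  have h2 := abs_add_le x.b y.b
  have h3 := abs_add_three x.z y.z (omega x y)
  have h4 := abs_omega_le hx.1 hx.2.1 hy.1 hy.2.1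
  obtain ⟨hx1, hx2, hx3⟩ := hx
  obtain ⟨hy1, hy2, hy3⟩ := hy
  have : (0 : ℤ) ≤ (M : ℤ) ^ 2 := by positivity
  refine ⟨?_, ?_, ?_⟩ <;> push_cast
  · rw [mul_a]; linarith
  · rw [mul_b]; linarith
  · change |x.z + y.z + omega x y| ≤ _
    nlinarith

/-! ### Adjusting the central coordinate by reordering -/

/-- The letters of `(i j r)^{2k}` can be reordered so that the central coordinate is the sum of
the central coordinates plus `2 ω(i, j) q`, for every `q < k (2 k - 1)`. The factor `r ^ k` on
either side makes the contribution of `r` to the reordering vanish; in the middle, `n` letters `j`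
are moved to the right end and one is moved by `e` places, where `q = k n + e`. -/
theorem exists_reordering (i j : SymHeis) (r : List SymHeis) (k q : ℕ) (hq : q < k * (2 * k - 1)) :
    ∃ u : List SymHeis, (∀ x ∈ u, x = i ∨ x = j ∨ x ∈ r) ∧
      u.length = 2 * k * r.length + 4 * k ∧
      u.prod.a = 2 * k * (i.a + j.a + r.prod.a) ∧
      u.prod.b = 2 * k * (i.b + j.b + r.prod.b) ∧
      u.prod.z = 2 * k * (i.z + j.z + r.prod.z) + 2 * omega i j * q := by
  have hk : 0 < k := Nat.pos_of_ne_zero (by rintro rfl; simp at hq)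
  obtain ⟨n, hn⟩ : ∃ n, n = q / k := ⟨_, rfl⟩
  obtain ⟨e, he⟩ : ∃ e, e = q % k := ⟨_, rfl⟩
  have hqe : k * n + e = q := by rw [hn, he]; exact Nat.div_add_mod q k
  have hek : e < k := he ▸ Nat.mod_lt _ hk
  have hn2 : n < 2 * k - 1 := hn ▸ Nat.div_lt_of_lt_mul hq
  obtain ⟨f, hf⟩ : ∃ f, k = e + f := ⟨k - e, by omega⟩
  obtain ⟨l, hl⟩ : ∃ l, 2 * k = n + 1 + l := ⟨2 * k - (n + 1), by omega⟩
  have hf' : (f : ℤ) = k - e := by omega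
  have hl' : (l : ℤ) = 2 * k - n - 1 := by omega
  have hq' : (q : ℤ) = k * n + e := by exact_mod_cast hqe.symm
  refine ⟨(List.replicate k r).flatten ++ (List.replicate k i ++ (List.replicate l j ++
    (List.replicate e i ++ ([j] ++ (List.replicate f i ++ (List.replicate n j ++
      (List.replicate k r).flatten)))))), ?_, ?_, ?_, ?_, ?_⟩
  · intro x hx
    simp only [List.mem_append, List.mem_flatten, List.mem_replicate, List.mem_singleton] at hx
    clear hq he hn hqe hn2 hl hf hf' hl' hq' hk hek
    aesop
  · simp only [List.length_append, List.length_flatten, List.map_replicate, List.sum_replicate,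
      List.length_replicate, List.length_singleton, smul_eq_mul]
    nlinarith only [hl, hf]
  all_goals
    simp only [List.prod_append, List.prod_flatten, List.map_replicate, List.prod_replicate]
    simp only [List.prod_singleton, mul_a, mul_b, mul_z, pow_a, pow_b, pow_z]
    try rw [omega]
    rw [hl', hf']
    try rw [hq']
    ring

/-- Two non-commuting letters `i, j` of a word `i j r` with the same abelianisation as `P` allow
every multiple of `2 ω(i, j)` to be realised as a difference of central coordinates of two words
with equal abelianisations, of length bounded by the data. -/
theorem exists_central_shift (i j : SymHeis) (r P : List SymHeis) (D : ℤ) (hij : omega i j ≠ 0)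
    (ha : i.a + j.a + r.prod.a = P.prod.a) (hb : i.b + j.b + r.prod.b = P.prod.b)
    (hD : 2 * omega i j ∣ D) (k : ℕ)
    (hk : (k : ℤ) = |omega i j| * (|D| + |i.z + j.z + r.prod.z - P.prod.z| + 2)) :
    ∃ u u' : List SymHeis, (∀ x ∈ u, x = i ∨ x = j ∨ x ∈ r) ∧ (∀ x ∈ u', x ∈ P) ∧
      u.length = 2 * k * r.length + 4 * k ∧ u'.length = 2 * k * P.length ∧
      u.prod.a = u'.prod.a ∧ u.prod.b = u'.prod.b ∧ u.prod.z - u'.prod.z = D := by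
  set l := i.z + j.z + r.prod.z - P.prod.z with hl
  have hpow : ∀ x ∈ (List.replicate (2 * k) P).flatten, x ∈ P := by
    intro x hx
    simp only [List.mem_flatten, List.mem_replicate] at hx
    aesop
  have hdk : omega i j ∣ k := hk ▸ (((dvd_abs _ _).2 dvd_rfl).mul_right _)
  obtain ⟨q, hq⟩ : 2 * omega i j ∣ D - 2 * k * l :=
    dvd_sub hD (Dvd.dvd.mul_right (mul_dvd_mul_left 2 hdk) l)
  have hdpos : 0 < |omega i j| := abs_pos.2 hij
  have hq1 : |q| ≤ |D| + 2 * k * |l| := by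
    have h1 : |q| ≤ |2 * omega i j * q| := by
      rw [abs_mul, abs_mul, abs_two]
      nlinarith [abs_nonneg q]
    rw [← hq] at h1
    refine h1.trans ((abs_sub _ _).trans ?_)
    rw [abs_mul, abs_mul, abs_two, Nat.abs_cast]
  have hk2 : |D| + |l| + 2 ≤ k := by
    rw [hk]; nlinarith [abs_nonneg D, abs_nonneg l]
  have hkpos : (0 : ℤ) < k := by linarith [abs_nonneg D, abs_nonneg l]
  have hq2 : q.natAbs < k * (2 * k - 1) := by
    zify [show 1 ≤ 2 * k by omega]
    nlinarith [abs_nonneg D, abs_nonneg l]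
  -- the sign of `q` decides which of the two letters is moved to the right
  rcases le_total 0 q with h0 | h0
  · obtain ⟨u, hu, hlen, hua, hub, huz⟩ := exists_reordering i j r k q.natAbs hq2
    refine ⟨u, (List.replicate (2 * k) P).flatten, hu, hpow, hlen, by simp, ?_, ?_, ?_⟩
    · rw [hua, ha]; simp [List.prod_flatten]
    · rw [hub, hb]; simp [List.prod_flatten]
    · rw [huz, Int.natCast_natAbs, abs_of_nonneg h0]
      simp only [List.prod_flatten, List.map_replicate, List.prod_replicate, pow_z]
      push_cast
      linear_combination -hq + 2 * k * hl
  · obtain ⟨u, hu, hlen, hua, hub, huz⟩ := exists_reordering j i r k q.natAbs hq2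
    refine ⟨u, (List.replicate (2 * k) P).flatten, fun x hx => by have := hu x hx; tauto, hpow,
      hlen, by simp, ?_, ?_, ?_⟩
    · rw [hua, add_comm j.a, ha]; simp [List.prod_flatten]
    · rw [hub, add_comm j.b, hb]; simp [List.prod_flatten]
    · rw [huz, Int.natCast_natAbs, abs_of_nonpos h0]
      simp only [List.prod_flatten, List.map_replicate, List.prod_replicate, pow_z]
      unfold omega at hq ⊢
      push_cast
      linear_combination -hq + 2 * k * hl

/-! ### Extracting factors that are trivial modulo `m` -/

/-- All three coordinates are divisible by `m`. -/
def TrivialMod (m : ℕ) (x : SymHeis) : Prop := (m : ℤ) ∣ x.a ∧ (m : ℤ) ∣ x.b ∧ (m : ℤ) ∣ x.z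

theorem TrivialMod.mul {m : ℕ} {x y : SymHeis} (hx : x.TrivialMod m) (hy : y.TrivialMod m) :
    (x * y).TrivialMod m :=
  ⟨dvd_add hx.1 hy.1, dvd_add hx.2.1 hy.2.1,
    dvd_add (dvd_add hx.2.2 hy.2.2) (dvd_sub (hx.1.mul_right _) (hx.2.1.mul_right _))⟩

theorem trivialMod_flatten {m : ℕ} {L : List (List SymHeis)}
    (h : ∀ l ∈ L, l.prod.TrivialMod m) : L.flatten.prod.TrivialMod m := by
  induction L with
  | nil => simp [TrivialMod]
  | cons l L ih =>
    rw [List.flatten_cons, List.prod_append]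
    exact (h l List.mem_cons_self).mul (ih fun l' hl' => h l' (List.mem_cons_of_mem _ hl'))

/-- A word longer than the order of the Heisenberg group modulo `m` has a nonempty factor that is
trivial modulo `m`. -/
theorem exists_trivialMod_factor (m : ℕ) [NeZero m] (w : List SymHeis) (hw : m ^ 3 < w.length) :
    ∃ x y t, w = x ++ (y ++ t) ∧ y ≠ [] ∧ y.length ≤ m ^ 3 ∧ y.prod.TrivialMod m := by
  obtain ⟨i, hi, j, hj, hij, he⟩ := Finset.exists_ne_map_eq_of_card_lt_of_maps_to
    (s := Finset.range (m ^ 3 + 1)) (t := (Finset.univ : Finset (ZMod m × ZMod m × ZMod m)))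
    (f := fun n => (((w.take n).prod.a : ZMod m), ((w.take n).prod.b : ZMod m),
      ((w.take n).prod.z : ZMod m)))
    (by
      rw [Finset.card_univ, Fintype.card_prod, Fintype.card_prod, ZMod.card, Finset.card_range]
      have : m * (m * m) = m ^ 3 := by ring
      omega) (fun _ _ => by simp)
  wlog hlt : i < j generalizing i j
  · exact this j hj i hi hij.symm he.symm (by omega)
  simp only [Finset.mem_range] at hi hj
  have h1 : w.take j = w.take i ++ (w.take j).drop i := by
    conv_lhs => rw [← List.take_append_drop i (w.take j)]
    rw [List.take_take, min_eq_left hlt.le]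
  have hlen : ((w.take j).drop i).length = j - i := by
    rw [List.length_drop, List.length_take]; omega
  refine ⟨w.take i, (w.take j).drop i, w.drop j, ?_, ?_, by omega, ?_⟩
  · rw [← List.append_assoc, ← h1, List.take_append_drop]
  · rw [Ne, ← List.length_eq_zero_iff]; omega
  · simp only [Prod.mk.injEq, ZMod.intCast_eq_intCast_iff_dvd_sub] at he
    rw [h1, List.prod_append, mul_a, mul_b, mul_z] at he
    obtain ⟨ha, hb, hz⟩ := he
    rw [add_sub_cancel_left] at ha hb
    refine ⟨ha, hb, ?_⟩
    obtain ⟨c, hc⟩ := dvd_sub hz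
      (dvd_sub (hb.mul_left (w.take i).prod.a) (ha.mul_left (w.take i).prod.b))
    exact ⟨c, by linear_combination hc⟩

/-- Every word splits, up to order and modulo `m` in the central coordinate, into a short word and
short factors that are trivial modulo `m`. -/
theorem exists_trivialMod_split (m : ℕ) [NeZero m] (w : List SymHeis) :
    ∃ (w₀ : List SymHeis) (L : List (List SymHeis)),
      (∀ x ∈ w₀, x ∈ w) ∧ w₀.length ≤ m ^ 3 ∧
      (∀ l ∈ L, (∀ x ∈ l, x ∈ w) ∧ l.length ≤ m ^ 3 ∧ l.prod.TrivialMod m) ∧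
      w.prod.a = w₀.prod.a + (L.map fun l => l.prod.a).sum ∧
      w.prod.b = w₀.prod.b + (L.map fun l => l.prod.b).sum ∧
      (m : ℤ) ∣ w.prod.z - w₀.prod.z := by
  induction hn : w.length using Nat.strong_induction_on generalizing w with
  | _ n ih =>
    rcases le_or_gt w.length (m ^ 3) with hw | hw
    · exact ⟨w, [], by simp, hw, by simp, by simp, by simp, by simp⟩
    obtain ⟨x, y, t, rfl, hy0, hy, hyt⟩ := exists_trivialMod_factor m w hw
    have := List.length_pos_iff.2 hy0
    obtain ⟨w₀, L, h1, h2, h3, h4, h5, h6⟩ := ih (x ++ t).length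
      (by simp only [List.length_append] at *; omega) (x ++ t) rfl
    refine ⟨w₀, y :: L, fun s hs => ?_, h2, ?_, ?_, ?_, ?_⟩
    · have := h1 s hs
      simp only [List.mem_append] at *
      tauto
    · intro l hl
      rcases List.mem_cons.1 hl with rfl | hl
      · exact ⟨by simp +contextual, hy, hyt⟩
      · refine ⟨fun s hs => ?_, (h3 l hl).2⟩
        have := (h3 l hl).1 s hs
        simp only [List.mem_append] at *
        tauto
    · simp only [List.prod_append, mul_a, List.map_cons, List.sum_cons] at h4 ⊢
      linarith
    · simp only [List.prod_append, mul_b, List.map_cons, List.sum_cons] at h5 ⊢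
      linarith
    · obtain ⟨ha, hb, hz⟩ := hyt
      obtain ⟨c, hc⟩ := dvd_add (dvd_add h6 hz) (dvd_add
        (dvd_sub (hb.mul_left x.prod.a) (ha.mul_left x.prod.b))
        (dvd_sub (ha.mul_right t.prod.b) (hb.mul_right t.prod.a)))
      refine ⟨c, ?_⟩
      rw [← hc]
      simp only [List.prod_append, mul_a, mul_b, mul_z]
      ring

/-! ### Short solutions when recurrent letters do not commute -/

/-- `exists_small_balanced` in dimension three, in terms of the three coordinates. -/
theorem exists_small_balanced_three {α β : Type*} (fa fb fz : α → ℤ) (ga gb gz : β → ℤ)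
    (M : ℕ) (sa sb sz : ℤ) (A : Multiset α) (B : Multiset β)
    (hs : |sa| ≤ M ∧ |sb| ≤ M ∧ |sz| ≤ M)
    (hA : ∀ x ∈ A, |fa x| ≤ M ∧ |fb x| ≤ M ∧ |fz x| ≤ M)
    (hB : ∀ x ∈ B, |ga x| ≤ M ∧ |gb x| ≤ M ∧ |gz x| ≤ M)
    (ha : sa + (A.map fa).sum = (B.map ga).sum) (hb : sb + (A.map fb).sum = (B.map gb).sum)
    (hz : sz + (A.map fz).sum = (B.map gz).sum) :
    ∃ A' ≤ A, ∃ B' ≤ B, sa + (A'.map fa).sum = (B'.map ga).sum ∧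
      sb + (A'.map fb).sum = (B'.map gb).sum ∧ sz + (A'.map fz).sum = (B'.map gz).sum ∧
      A'.card + B'.card ≤ blockBound 3 M := by
  obtain ⟨A', hA', B', hB', h, hc⟩ := exists_small_balanced (d := 3)
    (fun x => ![fa x, fb x, fz x]) (fun x => ![ga x, gb x, gz x]) M ![sa, sb, sz] A B
    (by simpa [Fin.forall_fin_succ] using hs)
    (fun x hx => by simpa [Fin.forall_fin_succ] using hA x hx)
    (fun x hx => by simpa [Fin.forall_fin_succ] using hB x hx)
    (by simpa [Fin.forall_fin_succ] using ⟨ha, hb, hz⟩)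
  simp only [Fin.forall_fin_succ] at h
  exact ⟨A', hA', B', hB', by simpa using h.1, by simpa using h.2.1, by simpa using h.2.2, hc⟩

theorem sum_map_a (A : Multiset SymHeis) : (A.map a).sum = A.toList.prod.a := by
  conv_lhs => rw [← Multiset.coe_toList A, Multiset.map_coe, Multiset.sum_coe, ← prod_a]

theorem sum_map_b (A : Multiset SymHeis) : (A.map b).sum = A.toList.prod.b := by
  conv_lhs => rw [← Multiset.coe_toList A, Multiset.map_coe, Multiset.sum_coe, ← prod_b]

/-- A letter `g` is recurrent in `G` relative to `H` if it occurs in a word over `G` that has the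
same abelianisation as some word over `H`. These are the letters that can be used arbitrarily often
in solutions of `T * w.prod = v.prod`, as far as the abelianisation is concerned. -/
def Recurrent (G H : Set SymHeis) (g : SymHeis) : Prop :=
  ∃ p p' : List SymHeis, (∀ x ∈ p, x ∈ G) ∧ (∀ x ∈ p', x ∈ H) ∧ g ∈ p ∧
    p.prod.a = p'.prod.a ∧ p.prod.b = p'.prod.b

theorem Recurrent.exists_short {G H : Set SymHeis} {g : SymHeis} (hg : Recurrent G H g) {M : ℕ}
    (hG : ∀ x ∈ G, x.Bdd M) (hH : ∀ x ∈ H, x.Bdd M) :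
    ∃ r P : List SymHeis, (∀ x ∈ r, x ∈ G) ∧ (∀ x ∈ P, x ∈ H) ∧
      g.a + r.prod.a = P.prod.a ∧ g.b + r.prod.b = P.prod.b ∧
      r.length + P.length ≤ blockBound 3 M := by
  obtain ⟨p, p', hp, hp', hgp, ha, hb⟩ := hg
  obtain ⟨A, hA⟩ := Multiset.exists_cons_of_mem (Multiset.mem_coe.2 hgp)
  have hmem : ∀ x ∈ A, x ∈ G := fun x hx =>
    hp x (Multiset.mem_coe.1 (hA ▸ Multiset.mem_cons_of_mem hx))
  have hM := hG g (hp g hgp)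
  rw [prod_a, ← Multiset.sum_coe, ← Multiset.map_coe, hA, prod_a, ← Multiset.sum_coe,
    ← Multiset.map_coe, Multiset.map_cons, Multiset.sum_cons] at ha
  rw [prod_b, ← Multiset.sum_coe, ← Multiset.map_coe, hA, prod_b, ← Multiset.sum_coe,
    ← Multiset.map_coe, Multiset.map_cons, Multiset.sum_cons] at hb
  obtain ⟨A', hA', B', hB', h1, h2, -, hc⟩ := exists_small_balanced_three a b (fun _ => 0) a b
    (fun _ => 0) M g.a g.b 0 A p' ⟨hM.1, hM.2.1, by simp⟩
    (fun x hx => ⟨(hG x (hmem x hx)).1, (hG x (hmem x hx)).2.1, by simp⟩)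
    (fun x hx => ⟨(hH x (hp' x hx)).1, (hH x (hp' x hx)).2.1, by simp⟩) ha hb (by simp)
  refine ⟨A'.toList, B'.toList, fun x hx => hmem x (Multiset.mem_of_le hA' (by simpa using hx)),
    fun x hx => hp' x (Multiset.mem_of_le hB' (by simpa using hx)), ?_, ?_, by simpa using hc⟩
  · rw [← sum_map_a, ← sum_map_a, h1]
  · rw [← sum_map_b, ← sum_map_b, h2]

/-- Length bound for the words solving the equation in the abelianisation and modulo `m`, where
`m ^ 3 ≤ Q`. -/
def congruenceBound (M Q : ℕ) : ℕ := Q + blockBound 3 ((2 * Q + 1) * M) * Q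

theorem sum_map_prod_a (L : List (List SymHeis)) :
    (L.map fun l => l.prod.a).sum = L.flatten.prod.a := by
  induction L with
  | nil => simp
  | cons l L ih => simp [ih]

theorem sum_map_prod_b (L : List (List SymHeis)) :
    (L.map fun l => l.prod.b).sum = L.flatten.prod.b := by
  induction L with
  | nil => simp
  | cons l L ih => simp [ih]

theorem length_flatten_le (L : List (List SymHeis)) (K : ℕ) (h : ∀ l ∈ L, l.length ≤ K) :
    L.flatten.length ≤ L.length * K := by
  rw [List.length_flatten]
  simpa using List.sum_le_card_nsmul (L.map List.length) K (by simpa using h)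

/-- If `T w = v` is solvable, then there are short words `w₁`, `v₁` such that `T w₁` and `v₁` have
the same abelianisation and congruent central coordinates modulo `m`. -/
theorem exists_short_congruent (m : ℕ) [NeZero m] (M Q : ℕ) (hQ : m ^ 3 ≤ Q) (T : SymHeis)
    (hT : T.Bdd M) (w v : List SymHeis) (hw : ∀ x ∈ w, x.Bdd M) (hv : ∀ x ∈ v, x.Bdd M)
    (h : T * w.prod = v.prod) :
    ∃ w₁ v₁ : List SymHeis, (∀ x ∈ w₁, x ∈ w) ∧ (∀ x ∈ v₁, x ∈ v) ∧
      w₁.length ≤ congruenceBound M Q ∧ v₁.length ≤ congruenceBound M Q ∧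
      T.a + w₁.prod.a = v₁.prod.a ∧ T.b + w₁.prod.b = v₁.prod.b ∧
      (m : ℤ) ∣ v₁.prod.z - (T * w₁.prod).z := by
  obtain ⟨w₀, L, hw₀, hw₀l, hL, hwa, hwb, hwz⟩ := exists_trivialMod_split m w
  obtain ⟨v₀, L', hv₀, hv₀l, hL', hva, hvb, hvz⟩ := exists_trivialMod_split m v
  have hbd : ∀ (u l : List SymHeis), (∀ x ∈ u, x.Bdd M) → (∀ x ∈ l, x ∈ u) →
      l.length ≤ m ^ 3 → |l.prod.a| ≤ Q * M ∧ |l.prod.b| ≤ Q * M := by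
    intro u l hu hl hlen
    have := abs_prod_le fun x hx => hu x (hl x hx)
    have hlen' : (l.length : ℤ) ≤ Q := by exact_mod_cast hlen.trans hQ
    have : (l.length : ℤ) * M ≤ Q * M := by gcongr
    constructor <;> linarith
  have hTa := congrArg a h
  have hTb := congrArg b h
  have hTz := congrArg z h
  rw [mul_a] at hTa
  rw [mul_b] at hTb
  rw [mul_z] at hTz
  have hM0 : (0 : ℤ) ≤ M := by positivity
  have hQM : (0 : ℤ) ≤ Q * M := by positivity
  have hw₀b := hbd w w₀ hw hw₀ hw₀l
  have hv₀b := hbd v v₀ hv hv₀ hv₀l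
  obtain ⟨A, hA, B, hB, hABa, hABb, -, hc⟩ := exists_small_balanced_three
    (fun l : List SymHeis => l.prod.a) (fun l => l.prod.b) (fun _ => 0)
    (fun l : List SymHeis => l.prod.a) (fun l => l.prod.b) (fun _ => 0) ((2 * Q + 1) * M)
    (T.a + w₀.prod.a - v₀.prod.a) (T.b + w₀.prod.b - v₀.prod.b) 0 L L'
    (by
      have h1 := abs_sub (T.a + w₀.prod.a) v₀.prod.a
      have h2 := abs_sub (T.b + w₀.prod.b) v₀.prod.b
      have h3 := abs_add_le T.a w₀.prod.a
      have h4 := abs_add_le T.b w₀.prod.b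
      have h5 := hT.1
      have h6 := hT.2.1
      push_cast
      exact ⟨by linarith, by linarith, by rw [abs_zero]; linarith⟩)
    (fun l hl => by
      have := hbd w l hw (hL l hl).1 (hL l hl).2.1
      push_cast
      exact ⟨by linarith, by linarith, by rw [abs_zero]; linarith⟩)
    (fun l hl => by
      have := hbd v l hv (hL' l hl).1 (hL' l hl).2.1
      push_cast
      exact ⟨by linarith, by linarith, by rw [abs_zero]; linarith⟩)
    (by rw [Multiset.map_coe, Multiset.map_coe, Multiset.sum_coe, Multiset.sum_coe]; linarith)
    (by rw [Multiset.map_coe, Multiset.map_coe, Multiset.sum_coe, Multiset.sum_coe]; linarith)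
    (by simp)
  rw [← Multiset.coe_toList A, ← Multiset.coe_toList B, Multiset.map_coe, Multiset.map_coe,
    Multiset.sum_coe, Multiset.sum_coe] at hABa hABb
  rw [sum_map_prod_a, sum_map_prod_a] at hABa
  rw [sum_map_prod_b, sum_map_prod_b] at hABb
  have hAL : ∀ l ∈ A.toList, l ∈ L := fun l hl => Multiset.mem_of_le hA (by simpa using hl)
  have hBL : ∀ l ∈ B.toList, l ∈ L' := fun l hl => Multiset.mem_of_le hB (by simpa using hl)
  have htA := trivialMod_flatten fun l hl => (hL l (hAL l hl)).2.2
  have htB := trivialMod_flatten fun l hl => (hL' l (hBL l hl)).2.2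
  have htL := trivialMod_flatten fun l hl => (hL l hl).2.2
  have hlenA := length_flatten_le A.toList Q fun l hl => (hL l (hAL l hl)).2.1.trans hQ
  have hlenB := length_flatten_le B.toList Q fun l hl => (hL' l (hBL l hl)).2.1.trans hQ
  rw [sum_map_prod_a] at hwa
  rw [sum_map_prod_b] at hwb
  rw [Multiset.length_toList] at hlenA hlenB
  have hcA : A.card * Q ≤ blockBound 3 ((2 * Q + 1) * M) * Q := Nat.mul_le_mul_right _ (by omega)
  have hcB : B.card * Q ≤ blockBound 3 ((2 * Q + 1) * M) * Q := Nat.mul_le_mul_right _ (by omega)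
  refine ⟨w₀ ++ A.toList.flatten, v₀ ++ B.toList.flatten, ?_, ?_, ?_, ?_, ?_, ?_, ?_⟩
  · intro x hx
    rcases List.mem_append.1 hx with hx | hx
    · exact hw₀ x hx
    · obtain ⟨l, hl, hxl⟩ := List.mem_flatten.1 hx
      exact (hL l (hAL l hl)).1 x hxl
  · intro x hx
    rcases List.mem_append.1 hx with hx | hx
    · exact hv₀ x hx
    · obtain ⟨l, hl, hxl⟩ := List.mem_flatten.1 hx
      exact (hL' l (hBL l hl)).1 x hxl
  · rw [List.length_append, congruenceBound]; omega
  · rw [List.length_append, congruenceBound]; omega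
  · rw [List.prod_append, List.prod_append, mul_a, mul_a]; linarith
  · rw [List.prod_append, List.prod_append, mul_b, mul_b]; linarith
  · obtain ⟨hA1, hA2, hA3⟩ := htA
    obtain ⟨hB1, hB2, hB3⟩ := htB
    obtain ⟨hL1, hL2, -⟩ := htL
    have e1 := dvd_sub (dvd_sub hwz hvz) (hA3.sub hB3)
    -- all cross terms involve a coordinate of a factor that is trivial modulo `m`
    have e2 := dvd_sub (hB2.mul_left v₀.prod.a) (hB1.mul_left v₀.prod.b)
    have e3 := dvd_sub (hA2.mul_left w₀.prod.a) (hA1.mul_left w₀.prod.b)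
    have e4 := dvd_sub ((hL2.sub hA2).mul_left T.a) ((hL1.sub hA1).mul_left T.b)
    obtain ⟨c, hc⟩ := ((e1.add e2).sub e3).add e4
    refine ⟨c, ?_⟩
    rw [← hc]
    simp only [List.prod_append, mul_a, mul_b, mul_z]
    rw [hwa, hwb] at hTz
    linear_combination -hTz

/-- Length bound for short solutions if two recurrent letters do not commute. -/
def nonCommutingBound (M : ℕ) : ℕ :=
  2 * congruenceBound M ((4 * M ^ 2) ^ 3) +
    (2 * M ^ 2 * (2 * centralBound M (congruenceBound M ((4 * M ^ 2) ^ 3) + 1) +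
      (2 * M + 2 * centralBound M (2 * blockBound 3 M)) + 2)) * (4 * blockBound 3 M + 4)

theorem exists_short_of_not_commute {G H : Set SymHeis} {M : ℕ}
    (hG : ∀ x ∈ G, x.Bdd M) (hH : ∀ x ∈ H, x.Bdd M) {i j : SymHeis} (hi : Recurrent G H i)
    (hj : Recurrent G H j) (hij : omega i j ≠ 0) {T : SymHeis} (hT : T.Bdd M)
    {w v : List SymHeis} (hw : ∀ x ∈ w, x ∈ G) (hv : ∀ x ∈ v, x ∈ H) (h : T * w.prod = v.prod) :
    ∃ w' v' : List SymHeis, (∀ x ∈ w', x ∈ G) ∧ (∀ x ∈ v', x ∈ H) ∧ T * w'.prod = v'.prod ∧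
      w'.length + v'.length ≤ nonCommutingBound M := by
  have hiG : i ∈ G := by obtain ⟨p, -, hp, -, hip, -⟩ := hi; exact hp i hip
  have hjG : j ∈ G := by obtain ⟨p, -, hp, -, hip, -⟩ := hj; exact hp j hip
  have hiM := hG i hiG
  have hjM := hG j hjG
  have hom := abs_omega_le hiM.1 hiM.2.1 hjM.1 hjM.2.1
  have : NeZero (2 * (omega i j).natAbs) := ⟨by simpa using hij⟩
  have hm : 2 * (omega i j).natAbs ≤ 4 * M ^ 2 := by zify; linarith
  obtain ⟨w₁, v₁, hw₁, hv₁, hlw, hlv, ha, hb, hz⟩ := exists_short_congruent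
    (2 * (omega i j).natAbs) M ((4 * M ^ 2) ^ 3) (Nat.pow_le_pow_left hm 3) T hT w v
    (fun x hx => hG x (hw x hx)) (fun x hx => hH x (hv x hx)) h
  obtain ⟨r₁, P₁, hr₁, hP₁, ha₁, hb₁, hl₁⟩ := hi.exists_short hG hH
  obtain ⟨r₂, P₂, hr₂, hP₂, ha₂, hb₂, hl₂⟩ := hj.exists_short hG hH
  set D := v₁.prod.z - (T * w₁.prod).z with hD
  set r := r₁ ++ r₂ with hr
  set P := P₁ ++ P₂ with hP
  have hrG : ∀ x ∈ r, x ∈ G := fun x hx => (List.mem_append.1 hx).elim (hr₁ x) (hr₂ x)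
  have hPH : ∀ x ∈ P, x ∈ H := fun x hx => (List.mem_append.1 hx).elim (hP₁ x) (hP₂ x)
  have hrl : r.length + P.length ≤ 2 * blockBound 3 M := by
    simp only [hr, hP, List.length_append]; omega
  obtain ⟨k, hk⟩ : ∃ k : ℕ, (k : ℤ) =
      |omega i j| * (|D| + |i.z + j.z + r.prod.z - P.prod.z| + 2) :=
    Int.eq_ofNat_of_zero_le (by positivity) |>.imp fun _ h => h.symm
  obtain ⟨u, u', hu, hu', hul, hul', hua, hub, huz⟩ := exists_central_shift i j r P D hij
    (by rw [hr, hP, List.prod_append, List.prod_append, mul_a, mul_a]; linarith)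
    (by rw [hr, hP, List.prod_append, List.prod_append, mul_b, mul_b]; linarith)
    (by
      refine (dvd_abs _ _).1 ?_ |>.trans hz
      push_cast
      rw [abs_mul, abs_abs, ← abs_mul]
      exact (dvd_abs _ _).2 dvd_rfl) k hk
  refine ⟨w₁ ++ u, v₁ ++ u', ?_, ?_, ?_, ?_⟩
  · intro x hx
    rcases List.mem_append.1 hx with hx | hx
    · exact hw x (hw₁ x hx)
    · rcases hu x hx with rfl | rfl | hx
      exacts [hiG, hjG, hrG x hx]
  · intro x hx
    rcases List.mem_append.1 hx with hx | hx
    exacts [hv x (hv₁ x hx), hPH x (hu' x hx)]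
  · rw [List.prod_append, List.prod_append, ← mul_assoc]
    have ha' : (T * w₁.prod).a = v₁.prod.a := ha
    have hb' : (T * w₁.prod).b = v₁.prod.b := hb
    ext
    · rw [mul_a (T * w₁.prod), mul_a v₁.prod, ha', hua]
    · rw [mul_b (T * w₁.prod), mul_b v₁.prod, hb', hub]
    · rw [mul_z (T * w₁.prod), mul_z v₁.prod, ha', hb', hua, hub]; linarith
  · have hDb : |D| ≤ (2 * centralBound M (congruenceBound M ((4 * M ^ 2) ^ 3) + 1) : ℕ) := by
      have h1 := (abs_prod_le (M := M) (w := T :: w₁) (by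
        intro x hx
        rcases List.mem_cons.1 hx with rfl | hx
        exacts [hT, hG x (hw x (hw₁ x hx))])).2.2
      have h2 := (abs_prod_le fun x hx => hH x (hv x (hv₁ x hx))).2.2
      rw [List.length_cons, List.prod_cons] at h1
      have h3 : (centralBound M (w₁.length + 1) : ℤ) ≤
          centralBound M (congruenceBound M ((4 * M ^ 2) ^ 3) + 1) := by
        exact_mod_cast centralBound_mono M (by omega)
      have h4 : (centralBound M v₁.length : ℤ) ≤
          centralBound M (congruenceBound M ((4 * M ^ 2) ^ 3) + 1) := by
        exact_mod_cast centralBound_mono M (by omega)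
      have := abs_sub v₁.prod.z (T * w₁.prod).z
      push_cast
      linarith
    have hlb : |i.z + j.z + r.prod.z - P.prod.z| ≤
        (2 * M + 2 * centralBound M (2 * blockBound 3 M) : ℕ) := by
      have h1 := (abs_prod_le fun x hx => hG x (hrG x hx)).2.2
      have h2 := (abs_prod_le fun x hx => hH x (hPH x hx)).2.2
      have h3 : (centralBound M r.length : ℤ) ≤ centralBound M (2 * blockBound 3 M) := by
        exact_mod_cast centralBound_mono M (by omega)
      have h4 : (centralBound M P.length : ℤ) ≤ centralBound M (2 * blockBound 3 M) := by
        exact_mod_cast centralBound_mono M (by omega)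
      have h5 := abs_sub (i.z + j.z + r.prod.z) P.prod.z
      have h6 := abs_add_three i.z j.z r.prod.z
      have h7 := hiM.2.2
      have h8 := hjM.2.2
      push_cast
      linarith
    have hkb : k ≤ 2 * M ^ 2 * (2 * centralBound M (congruenceBound M ((4 * M ^ 2) ^ 3) + 1) +
        (2 * M + 2 * centralBound M (2 * blockBound 3 M)) + 2) := by
      zify
      rw [hk]
      have hom' : |omega i j| ≤ 2 * (M : ℤ) ^ 2 := by linarith
      push_cast at hDb hlb
      gcongr
    rw [List.length_append, List.length_append, hul, hul', nonCommutingBound]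
    have h1 := Nat.mul_le_mul_left (2 * k) hrl
    have h2 := Nat.mul_le_mul_right (4 * blockBound 3 M + 4) hkb
    generalize 2 * M ^ 2 * _ = K at h2 ⊢
    linarith

/-! ### Short solutions when recurrent letters commute -/

/-- In a solution of the abelianised equation, the letters lying outside one suitable balanced
part of bounded size are recurrent. Hence only boundedly many letters are not recurrent. -/
theorem length_filter_not_recurrent_le {G H : Set SymHeis} {M : ℕ} (hG : ∀ x ∈ G, x.Bdd M)
    (hH : ∀ x ∈ H, x.Bdd M) [DecidablePred (Recurrent G H)] {sa sb : ℤ} (hsa : |sa| ≤ M)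
    (hsb : |sb| ≤ M) {w v : List SymHeis} (hw : ∀ x ∈ w, x ∈ G) (hv : ∀ x ∈ v, x ∈ H)
    (ha : sa + w.prod.a = v.prod.a) (hb : sb + w.prod.b = v.prod.b) :
    (w.filter (¬ Recurrent G H ·)).length ≤ blockBound 3 M := by
  rw [prod_a, ← Multiset.sum_coe, ← Multiset.map_coe, prod_a, ← Multiset.sum_coe,
    ← Multiset.map_coe] at ha
  rw [prod_b, ← Multiset.sum_coe, ← Multiset.map_coe, prod_b, ← Multiset.sum_coe,
    ← Multiset.map_coe] at hb
  obtain ⟨A, hA, B, hB, h1, h2, -, hc⟩ := exists_small_balanced_three a b (fun _ => 0) a b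
    (fun _ => 0) M sa sb 0 (w : Multiset SymHeis) v ⟨hsa, hsb, by simp⟩
    (fun x hx => ⟨(hG x (hw x hx)).1, (hG x (hw x hx)).2.1, by simp⟩)
    (fun x hx => ⟨(hH x (hv x hx)).1, (hH x (hv x hx)).2.1, by simp⟩) ha hb (by simp)
  obtain ⟨A', hA'⟩ := Multiset.le_iff_exists_add.1 hA
  obtain ⟨B', hB'⟩ := Multiset.le_iff_exists_add.1 hB
  have hrec : ∀ x ∈ A', Recurrent G H x := by
    intro x hx
    refine ⟨A'.toList, B'.toList, fun y hy => hw y ?_, fun y hy => hv y ?_,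
      Multiset.mem_toList.2 hx, ?_, ?_⟩
    · rw [← Multiset.mem_coe, hA']
      exact Multiset.mem_add.2 (Or.inr (Multiset.mem_toList.1 hy))
    · rw [← Multiset.mem_coe, hB']
      exact Multiset.mem_add.2 (Or.inr (Multiset.mem_toList.1 hy))
    · rw [hA', hB', Multiset.map_add, Multiset.map_add, Multiset.sum_add, Multiset.sum_add] at ha
      rw [← sum_map_a, ← sum_map_a]
      linarith
    · rw [hA', hB', Multiset.map_add, Multiset.map_add, Multiset.sum_add, Multiset.sum_add] at hb
      rw [← sum_map_b, ← sum_map_b]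
      linarith
  rw [← Multiset.coe_card, ← Multiset.filter_coe, hA', Multiset.filter_add,
    Multiset.filter_eq_nil.2 fun x hx => not_not.2 (hrec x hx), add_zero]
  exact (Multiset.card_le_card (Multiset.filter_le _ _)).trans (by omega)

theorem omega_prod_filter (U : SymHeis → Prop) [DecidablePred U] (x : SymHeis) (w : List SymHeis)
    (h : ∀ y ∈ w, U y → omega x y = 0) :
    omega x w.prod = omega x (w.filter (¬ U ·)).prod := by
  induction w with
  | nil => rfl
  | cons y w ih =>
    have ih' := ih fun z hz => h z (List.mem_cons_of_mem _ hz)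
    by_cases hy : U y
    · have h1 := h y List.mem_cons_self hy
      rw [List.filter_cons_of_neg (by simpa using hy), ← ih', List.prod_cons]
      simp only [omega, mul_a, mul_b] at h1 ⊢
      linear_combination h1
    · rw [List.filter_cons_of_pos (by simpa using hy), List.prod_cons, List.prod_cons]
      simp only [omega, mul_a, mul_b] at ih' ⊢
      linear_combination ih'

/-- If the letters of `w` satisfying `U` commute with each other, the value of `w` (including the
commutator with an element whose abelianisation is `(pa, pb)`) is a constant plus a sum of
contributions in `ℤ³`, one for each occurrence of a letter satisfying `U`, and it stays so if some
of these occurrences are deleted. The contribution of an occurrence depends only on the letter and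
on the letters before and after it which do not satisfy `U`. -/
theorem exists_linearisation (U : SymHeis → Prop) [DecidablePred U] (M R : ℕ) (w : List SymHeis)
    (hM : ∀ x ∈ w, x.Bdd M) (hU : ∀ x ∈ w, ∀ y ∈ w, U x → U y → omega x y = 0) (pa pb : ℤ)
    (hpa : |pa| + M * (w.filter (¬ U ·)).length ≤ R)
    (hpb : |pb| + M * (w.filter (¬ U ·)).length ≤ R) :
    ∃ (C : Multiset (ℤ × ℤ × ℤ)) (K : ℤ),
      (∀ c ∈ C, |c.1| ≤ M ∧ |c.2.1| ≤ M ∧ |c.2.2| ≤ M + 4 * R * M) ∧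
      |K| ≤ (w.filter (¬ U ·)).length * (M + 2 * R * M) ∧
      w.prod.a = (w.filter (¬ U ·)).prod.a + (C.map fun c => c.1).sum ∧
      w.prod.b = (w.filter (¬ U ·)).prod.b + (C.map fun c => c.2.1).sum ∧
      w.prod.z + (pa * w.prod.b - pb * w.prod.a) = K + (C.map fun c => c.2.2).sum ∧
      ∀ t ≤ C, ∃ w' : List SymHeis, (∀ x ∈ w', x ∈ w) ∧
        w'.filter (¬ U ·) = w.filter (¬ U ·) ∧
        w'.prod.a = (w.filter (¬ U ·)).prod.a + (t.map fun c => c.1).sum ∧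
        w'.prod.b = (w.filter (¬ U ·)).prod.b + (t.map fun c => c.2.1).sum ∧
        w'.prod.z + (pa * w'.prod.b - pb * w'.prod.a) = K + (t.map fun c => c.2.2).sum ∧
        w'.length = (w.filter (¬ U ·)).length + t.card := by
  induction w generalizing pa pb with
  | nil =>
    refine ⟨0, 0, by simp, by simp, by simp, by simp, by simp, fun t ht => ⟨[], ?_⟩⟩
    obtain rfl := Multiset.le_zero.1 ht
    simp
  | cons x w ih =>
    have hM' : ∀ y ∈ w, y.Bdd M := fun y hy => hM y (List.mem_cons_of_mem _ hy)
    have hU' : ∀ y ∈ w, ∀ y' ∈ w, U y → U y' → omega y y' = 0 := fun y hy y' hy' =>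
      hU y (List.mem_cons_of_mem _ hy) y' (List.mem_cons_of_mem _ hy')
    obtain ⟨hxa, hxb, hxz⟩ := hM x List.mem_cons_self
    have hM0 : (0 : ℤ) ≤ M := by positivity
    have hp : |pa * x.b - pb * x.a| ≤ 2 * R * M := by
      have h1 : (0 : ℤ) ≤ M * ((x :: w).filter (¬ U ·)).length := by positivity
      exact abs_omega_le (x := ⟨pa, pb, 0⟩) (by change |pa| ≤ _; linarith)
        (by change |pb| ≤ _; linarith) hxa hxb
    by_cases hx : U x
    · rw [List.filter_cons_of_neg (by simpa using hx)] at hpa hpb ⊢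
      obtain ⟨C, K, h1, h2, h3, h4, h5, h6⟩ := ih hM' hU' pa pb hpa hpb
      obtain ⟨N, hN⟩ : ∃ N, N = (w.filter (¬ U ·)).prod := ⟨_, rfl⟩
      rw [← hN] at h3 h4 h6 ⊢
      have hNb : |omega x N| ≤ 2 * M * R := by
        have h := abs_prod_le fun y hy => hM' y (List.mem_of_mem_filter (p := (¬ U ·)) hy)
        rw [← hN] at h
        have := abs_nonneg pa
        exact abs_omega_le hxa hxb (by linarith [h.1]) (by linarith [h.2.1])
      have key : ∀ w' : List SymHeis, (∀ y ∈ w', y ∈ w) → w'.filter (¬ U ·) = w.filter (¬ U ·) →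
          omega x w'.prod = omega x N := by
        intro w' hw' hf
        rw [omega_prod_filter U x w' fun y hy hUy => hU x List.mem_cons_self y
          (List.mem_cons_of_mem _ (hw' y hy)) hx hUy, hf, hN]
      refine ⟨(x.a, x.b, x.z + (pa * x.b - pb * x.a) + omega x N) ::ₘ C, K, ?_, h2, ?_, ?_, ?_, ?_⟩
      · intro c hc
        rcases Multiset.mem_cons.1 hc with rfl | hc
        · refine ⟨hxa, hxb, (abs_add_three _ _ _).trans ?_⟩
          linarith
        · exact h1 c hc
      · rw [List.prod_cons, mul_a, Multiset.map_cons, Multiset.sum_cons, h3]; ring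
      · rw [List.prod_cons, mul_b, Multiset.map_cons, Multiset.sum_cons, h4]; ring
      · have := key w (fun _ h => h) rfl
        rw [omega] at this
        rw [List.prod_cons, mul_a, mul_b, mul_z, Multiset.map_cons, Multiset.sum_cons]
        linear_combination h5 + this
      · intro t ht
        by_cases hmem : (x.a, x.b, x.z + (pa * x.b - pb * x.a) + omega x N) ∈ t
        · obtain ⟨t, rfl⟩ := Multiset.exists_cons_of_mem hmem
          obtain ⟨w', k1, k2, k3, k4, k5, k6⟩ := h6 t ((Multiset.cons_le_cons_iff _).1 ht)
          have := key w' k1 k2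
          rw [omega] at this
          refine ⟨x :: w', fun y hy => ?_, ?_, ?_, ?_, ?_, ?_⟩
          · rcases List.mem_cons.1 hy with rfl | hy
            exacts [List.mem_cons_self, List.mem_cons_of_mem _ (k1 y hy)]
          · rw [List.filter_cons_of_neg (by simpa using hx), k2]
          · rw [List.prod_cons, mul_a, Multiset.map_cons, Multiset.sum_cons, k3]; ring
          · rw [List.prod_cons, mul_b, Multiset.map_cons, Multiset.sum_cons, k4]; ring
          · rw [List.prod_cons, mul_a, mul_b, mul_z, Multiset.map_cons, Multiset.sum_cons]
            linear_combination k5 + this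
          · rw [List.length_cons, k6, Multiset.card_cons]; ring
        · obtain ⟨w', k1, k2⟩ := h6 t ((Multiset.le_cons_of_notMem hmem).1 ht)
          exact ⟨w', fun y hy => List.mem_cons_of_mem _ (k1 y hy), k2⟩
    · rw [List.filter_cons_of_pos (by simpa using hx)] at hpa hpb ⊢
      rw [List.length_cons] at hpa hpb ⊢
      push_cast at hpa hpb ⊢
      obtain ⟨C, K, h1, h2, h3, h4, h5, h6⟩ := ih hM' hU' (pa + x.a) (pb + x.b)
        (by linarith [abs_add_le pa x.a]) (by linarith [abs_add_le pb x.b])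
      refine ⟨C, x.z + (pa * x.b - pb * x.a) + K, h1, ?_, ?_, ?_, ?_, ?_⟩
      · refine (abs_add_three _ _ _).trans ?_
        linarith
      · rw [List.prod_cons, List.prod_cons, mul_a, mul_a, h3]; ring
      · rw [List.prod_cons, List.prod_cons, mul_b, mul_b, h4]; ring
      · rw [List.prod_cons, mul_a, mul_b, mul_z]
        linear_combination h5
      · intro t ht
        obtain ⟨w', k1, k2, k3, k4, k5, k6⟩ := h6 t ht
        refine ⟨x :: w', fun y hy => ?_, ?_, ?_, ?_, ?_, ?_⟩
        · rcases List.mem_cons.1 hy with rfl | hy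
          exacts [List.mem_cons_self, List.mem_cons_of_mem _ (k1 y hy)]
        · rw [List.filter_cons_of_pos (by simpa using hx), k2]
        · rw [List.prod_cons, List.prod_cons, mul_a, mul_a, k3]; ring
        · rw [List.prod_cons, List.prod_cons, mul_b, mul_b, k4]; ring
        · rw [List.prod_cons, mul_a, mul_b, mul_z]
          linear_combination k5
        · rw [List.length_cons, k6]; ring

/-- The entries of the vectors in `ℤ³` into which a solution is decomposed if the recurrent letters
commute and there are at most `F` others. -/
def linearEntryBound (M F : ℕ) : ℕ :=
  M + 2 * M * F + 2 * F * (M + 2 * (M + M * F) * M) + 4 * (M + M * F) * M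

/-- Length bound for short solutions if the recurrent letters commute. -/
def commutingBound (M : ℕ) : ℕ :=
  2 * blockBound 3 M + blockBound 3 (linearEntryBound M (blockBound 3 M))

theorem exists_short_of_commute {G H : Set SymHeis} {M : ℕ}
    (hG : ∀ x ∈ G, x.Bdd M) (hH : ∀ x ∈ H, x.Bdd M)
    (hcG : ∀ i j, Recurrent G H i → Recurrent G H j → omega i j = 0)
    (hcH : ∀ i j, Recurrent H G i → Recurrent H G j → omega i j = 0) {T : SymHeis} (hT : T.Bdd M)
    {w v : List SymHeis} (hw : ∀ x ∈ w, x ∈ G) (hv : ∀ x ∈ v, x ∈ H) (h : T * w.prod = v.prod) :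
    ∃ w' v' : List SymHeis, (∀ x ∈ w', x ∈ G) ∧ (∀ x ∈ v', x ∈ H) ∧ T * w'.prod = v'.prod ∧
      w'.length + v'.length ≤ commutingBound M := by
  classical
  have hTa : T.a + w.prod.a = v.prod.a := congrArg a h
  have hTb : T.b + w.prod.b = v.prod.b := congrArg b h
  have hTz := congrArg z h
  rw [mul_z] at hTz
  have hnw := length_filter_not_recurrent_le hG hH hT.1 hT.2.1 hw hv hTa hTb
  have hnv := length_filter_not_recurrent_le hH hG (sa := -T.a) (sb := -T.b)
    (by rw [abs_neg]; exact hT.1) (by rw [abs_neg]; exact hT.2.1) hv hw (by linarith) (by linarith)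
  obtain ⟨F, hF⟩ : ∃ F, F = blockBound 3 M := ⟨_, rfl⟩
  rw [← hF] at hnw hnv
  have hnw' : ((w.filter (¬ Recurrent G H ·)).length : ℤ) ≤ F := by exact_mod_cast hnw
  have hnv' : ((v.filter (¬ Recurrent H G ·)).length : ℤ) ≤ F := by exact_mod_cast hnv
  have hM0 : (0 : ℤ) ≤ M := by positivity
  have hMw : (M : ℤ) * (w.filter (¬ Recurrent G H ·)).length ≤ M * F := by gcongr
  have hMv : (M : ℤ) * (v.filter (¬ Recurrent H G ·)).length ≤ M * F := by gcongr
  obtain ⟨C, K, h1, h2, h3, h4, h5, h6⟩ := exists_linearisation (Recurrent G H) M (M + M * F) w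
    (fun x hx => hG x (hw x hx)) (fun x _ y _ => hcG x y) T.a T.b
    (by push_cast; linarith [hT.1]) (by push_cast; linarith [hT.2.1])
  obtain ⟨C', K', h1', h2', h3', h4', h5', h6'⟩ := exists_linearisation (Recurrent H G) M
    (M + M * F) v (fun x hx => hH x (hv x hx)) (fun x _ y _ => hcH x y) 0 0
    (by rw [abs_zero]; push_cast; linarith) (by rw [abs_zero]; push_cast; linarith)
  have hNw := abs_prod_le fun x hx =>
    hG x (hw x (List.mem_of_mem_filter (p := (¬ Recurrent G H ·)) hx))
  have hNv := abs_prod_le fun x hx =>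
    hH x (hv x (List.mem_of_mem_filter (p := (¬ Recurrent H G ·)) hx))
  generalize hNwe : (w.filter (¬ Recurrent G H ·)).prod = Nw at *
  generalize hNve : (v.filter (¬ Recurrent H G ·)).prod = Nv at *
  push_cast at h1 h1' h2 h2'
  have hE : (0 : ℤ) ≤ M + 2 * (M + M * F) * M := by positivity
  have hK : |K| ≤ F * (M + 2 * (M + M * F) * M) := h2.trans (by gcongr)
  have hK' : |K'| ≤ F * (M + 2 * (M + M * F) * M) := h2'.trans (by gcongr)
  have hMF : (0 : ℤ) ≤ M * F := by positivity
  have hMFM : (0 : ℤ) ≤ (M + M * F) * M := by positivity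
  have hFE : (0 : ℤ) ≤ F * (M + 2 * (M + M * F) * M) := by positivity
  have hML : (M : ℤ) ≤ linearEntryBound M F := by
    rw [linearEntryBound]; push_cast; linarith
  have hCL : (M : ℤ) + 4 * (M + M * F) * M ≤ linearEntryBound M F := by
    rw [linearEntryBound]; push_cast; linarith
  obtain ⟨A, hA, B, hB, e1, e2, e3, hc⟩ := exists_small_balanced_three
    (fun c : ℤ × ℤ × ℤ => c.1) (fun c => c.2.1) (fun c => c.2.2)
    (fun c : ℤ × ℤ × ℤ => c.1) (fun c => c.2.1) (fun c => c.2.2) (linearEntryBound M F)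
    (T.a + Nw.a - Nv.a) (T.b + Nw.b - Nv.b) (T.z + K - K') C C'
    (by
      have k1 := abs_sub (T.a + Nw.a) Nv.a
      have k2 := abs_sub (T.b + Nw.b) Nv.b
      have k3 := abs_sub (T.z + K) K'
      have k4 := abs_add_le T.a Nw.a
      have k5 := abs_add_le T.b Nw.b
      have k6 := abs_add_le T.z K
      obtain ⟨t1, t2, t3⟩ := hT
      obtain ⟨n1, n2, -⟩ := hNw
      obtain ⟨m1, m2, -⟩ := hNv
      rw [linearEntryBound]
      push_cast
      exact ⟨by linarith, by linarith, by linarith⟩)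
    (fun c hc => ⟨(h1 c hc).1.trans hML, (h1 c hc).2.1.trans hML, (h1 c hc).2.2.trans hCL⟩)
    (fun c hc => ⟨(h1' c hc).1.trans hML, (h1' c hc).2.1.trans hML, (h1' c hc).2.2.trans hCL⟩)
    (by linarith) (by linarith) (by linarith)
  obtain ⟨w', a1, -, a3, a4, a5, a6⟩ := h6 A hA
  obtain ⟨v', b1, -, b3, b4, b5, b6⟩ := h6' B hB
  refine ⟨w', v', fun x hx => hw x (a1 x hx), fun x hx => hv x (b1 x hx), ?_, ?_⟩
  · ext
    · rw [mul_a]; linarith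
    · rw [mul_b]; linarith
    · rw [mul_z]; linarith
  · rw [commutingBound, a6, b6, ← hF]; omega

/-! ### The small-solution property -/

/-- Length bound for shortest solutions of `T * w.prod = v.prod` with entries at most `M`. -/
def solutionBound (M : ℕ) : ℕ := nonCommutingBound M + commutingBound M

/-- If `T * w.prod = v.prod` is solvable in words `w` over `G` and `v` over `H`, then it has a
solution of length bounded in terms of the entries only. -/
theorem exists_short_solution {G H : Set SymHeis} {M : ℕ}
    (hG : ∀ x ∈ G, x.Bdd M) (hH : ∀ x ∈ H, x.Bdd M) {T : SymHeis} (hT : T.Bdd M)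
    {w v : List SymHeis} (hw : ∀ x ∈ w, x ∈ G) (hv : ∀ x ∈ v, x ∈ H) (h : T * w.prod = v.prod) :
    ∃ w' v' : List SymHeis, (∀ x ∈ w', x ∈ G) ∧ (∀ x ∈ v', x ∈ H) ∧ T * w'.prod = v'.prod ∧
      w'.length + v'.length ≤ solutionBound M := by
  unfold solutionBound
  by_cases hcG : ∀ i j, Recurrent G H i → Recurrent G H j → omega i j = 0
  · by_cases hcH : ∀ i j, Recurrent H G i → Recurrent H G j → omega i j = 0
    · obtain ⟨w', v', h1, h2, h3, h4⟩ := exists_short_of_commute hG hH hcG hcH hT hw hv h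
      exact ⟨w', v', h1, h2, h3, by omega⟩
    · push Not at hcH
      obtain ⟨i, j, hi, hj, hij⟩ := hcH
      -- the equation is symmetric: `T⁻¹ * v.prod = w.prod`
      obtain ⟨v', w', h1, h2, h3, h4⟩ := exists_short_of_not_commute hH hG hi hj hij hT.inv hv hw
        (by rw [← h, inv_mul_cancel_left])
      exact ⟨w', v', h2, h1, by rw [← h3, mul_inv_cancel_left], by omega⟩
  · push Not at hcG
    obtain ⟨i, j, hi, hj, hij⟩ := hcG
    obtain ⟨w', v', h1, h2, h3, h4⟩ := exists_short_of_not_commute hG hH hi hj hij hT hw hv h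
    exact ⟨w', v', h1, h2, h3, by omega⟩

/-- The version of `exists_short_solution` for nonempty words and two offsets: fix the first letters
`g` and `h`, and solve `(S h)⁻¹ (T g) w = v`. -/
theorem exists_short_orbit_solution {G H : Set SymHeis} {M : ℕ}
    (hG : ∀ x ∈ G, x.Bdd M) (hH : ∀ x ∈ H, x.Bdd M) {T S : SymHeis} (hT : T.Bdd M) (hS : S.Bdd M)
    {w v : List SymHeis} (hw : ∀ x ∈ w, x ∈ G) (hv : ∀ x ∈ v, x ∈ H) (hw0 : w ≠ []) (hv0 : v ≠ [])
    (h : T * w.prod = S * v.prod) {B : ℕ}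
    (hB : solutionBound (2 * (2 * M + 2 * M ^ 2) + 2 * (2 * M + 2 * M ^ 2) ^ 2) ≤ B) :
    ∃ w' v' : List SymHeis, (∀ x ∈ w', x ∈ G) ∧ (∀ x ∈ v', x ∈ H) ∧ w' ≠ [] ∧ v' ≠ [] ∧
      T * w'.prod = S * v'.prod ∧ w'.length ≤ B + 1 ∧ v'.length ≤ B + 1 := by
  obtain ⟨g, w, rfl⟩ := List.exists_cons_of_ne_nil hw0
  obtain ⟨k, v, rfl⟩ := List.exists_cons_of_ne_nil hv0
  have hg := hw g List.mem_cons_self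
  have hk := hv k List.mem_cons_self
  have hTb := (hS.mul (hH k hk)).inv.mul (hT.mul (hG g hg))
  have hle : M ≤ 2 * (2 * M + 2 * M ^ 2) + 2 * (2 * M + 2 * M ^ 2) ^ 2 := by
    have : 0 ≤ 3 * M + 4 * M ^ 2 + 2 * (2 * M + 2 * M ^ 2) ^ 2 := by positivity
    linarith
  obtain ⟨w', v', h1, h2, h3, h4⟩ := exists_short_solution (fun x hx => (hG x hx).mono hle)
    (fun x hx => (hH x hx).mono hle) hTb
    (fun x hx => hw x (List.mem_cons_of_mem _ hx)) (fun x hx => hv x (List.mem_cons_of_mem _ hx))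
    (by
      rw [List.prod_cons, List.prod_cons, ← mul_assoc, ← mul_assoc] at h
      rw [mul_assoc, h, inv_mul_cancel_left])
  refine ⟨g :: w', k :: v', fun x hx => ?_, fun x hx => ?_, by simp, by simp, ?_, ?_, ?_⟩
  · rcases List.mem_cons.1 hx with rfl | hx
    exacts [hg, h1 x hx]
  · rcases List.mem_cons.1 hx with rfl | hx
    exacts [hk, h2 x hx]
  · rw [List.prod_cons, List.prod_cons, ← h3, ← mul_assoc, ← mul_assoc, ← mul_assoc,
      ← mul_assoc, mul_inv_cancel, one_mul]
  · rw [List.length_cons]; omega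
  · rw [List.length_cons]; omega

end SymHeis

/-! ### Primitive recursive integer arithmetic -/

theorem Primrec.intEquivNatSumNat : Primrec Equiv.intEquivNatSumNat := by
  rw [← Primrec.encode_iff]
  refine Primrec.encode.of_eq fun z => ?_
  cases z <;> rfl

theorem Primrec.intEquivNatSumNat_symm : Primrec Equiv.intEquivNatSumNat.symm := by
  rw [← Primrec.encode_iff]
  refine Primrec.encode.of_eq fun s => ?_
  cases s <;> rfl

theorem Primrec.int_toNat : Primrec Int.toNat :=
  (Primrec.sumCasesOn (f := Equiv.intEquivNatSumNat) (g := fun _ n => n) (h := fun _ _ => 0)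
    Primrec.intEquivNatSumNat Primrec.snd.to₂ (Primrec.const 0).to₂).of_eq fun z => by
      cases z <;> rfl

theorem Primrec.int_neg_toNat : Primrec fun z : ℤ => (-z).toNat :=
  (Primrec.sumCasesOn (f := Equiv.intEquivNatSumNat) (g := fun _ _ => 0) (h := fun _ n => n + 1)
    Primrec.intEquivNatSumNat (Primrec.const 0).to₂ (Primrec.succ.comp Primrec.snd).to₂).of_eq
    fun z => by
      cases z with
      | ofNat n => change 0 = (-(n : ℤ)).toNat; omega
      | negSucc n => rfl

theorem Primrec.int_subNat : Primrec₂ fun p n : ℕ => (p : ℤ) - n := by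
  refine (Primrec.ite (Primrec.nat_le.comp Primrec.snd Primrec.fst)
    (Primrec.intEquivNatSumNat_symm.comp (Primrec.sumInl.comp
      (Primrec.nat_sub.comp Primrec.fst Primrec.snd)))
    (Primrec.intEquivNatSumNat_symm.comp (Primrec.sumInr.comp
      (Primrec.nat_sub.comp (Primrec.nat_sub.comp Primrec.snd Primrec.fst)
        (Primrec.const 1))))).of_eq fun x => ?_
  obtain ⟨p, n⟩ := x
  by_cases h : n ≤ p
  · rw [if_pos h]
    change ((p - n : ℕ) : ℤ) = p - n
    omega
  · rw [if_neg h]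
    change Int.negSucc (n - p - 1) = p - n
    omega

theorem Primrec.int_natCast : Primrec fun n : ℕ => (n : ℤ) :=
  (Primrec.int_subNat.comp Primrec.id (Primrec.const 0)).of_eq fun n => by simp

theorem Primrec.int_natAbs : Primrec Int.natAbs :=
  (Primrec.nat_add.comp Primrec.int_toNat Primrec.int_neg_toNat).of_eq fun z => by omega

theorem Primrec.int_add : Primrec₂ ((· + ·) : ℤ → ℤ → ℤ) :=
  (Primrec.int_subNat.comp
    (Primrec.nat_add.comp (Primrec.int_toNat.comp Primrec.fst) (Primrec.int_toNat.comp Primrec.snd))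
    (Primrec.nat_add.comp (Primrec.int_neg_toNat.comp Primrec.fst)
      (Primrec.int_neg_toNat.comp Primrec.snd))).of_eq fun x => by push_cast; omega

theorem Primrec.int_neg : Primrec (Neg.neg : ℤ → ℤ) :=
  (Primrec.int_subNat.comp Primrec.int_neg_toNat Primrec.int_toNat).of_eq fun z => by omega

theorem Primrec.int_sub : Primrec₂ ((· - ·) : ℤ → ℤ → ℤ) :=
  (Primrec.int_add.comp Primrec.fst (Primrec.int_neg.comp Primrec.snd)).of_eq fun x =>
    (sub_eq_add_neg x.1 x.2).symm

theorem Primrec.int_mul : Primrec₂ ((· * ·) : ℤ → ℤ → ℤ) :=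
  (Primrec.int_subNat.comp
    (Primrec.nat_add.comp
      (Primrec.nat_mul.comp (Primrec.int_toNat.comp Primrec.fst)
        (Primrec.int_toNat.comp Primrec.snd))
      (Primrec.nat_mul.comp (Primrec.int_neg_toNat.comp Primrec.fst)
        (Primrec.int_neg_toNat.comp Primrec.snd)))
    (Primrec.nat_add.comp
      (Primrec.nat_mul.comp (Primrec.int_toNat.comp Primrec.fst)
        (Primrec.int_neg_toNat.comp Primrec.snd))
      (Primrec.nat_mul.comp (Primrec.int_neg_toNat.comp Primrec.fst)
        (Primrec.int_toNat.comp Primrec.snd)))).of_eq fun x => by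
    obtain ⟨z, w⟩ := x
    have hz : (z.toNat : ℤ) - (-z).toNat = z := by omega
    have hw : (w.toNat : ℤ) - (-w).toNat = w := by omega
    push_cast
    conv_rhs => rw [← hz, ← hw]
    ring

namespace SymHeis

/-- `SymHeis` as a product. -/
def equivProd : SymHeis ≃ ℤ × ℤ × ℤ where
  toFun x := (x.a, x.b, x.z)
  invFun p := ⟨p.1, p.2.1, p.2.2⟩

instance : Primcodable SymHeis := Primcodable.ofEquiv _ equivProd

theorem primrec_a : Primrec a :=
  Primrec.fst.comp (Primrec.of_equiv (e := equivProd))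

theorem primrec_b : Primrec b :=
  Primrec.fst.comp (Primrec.snd.comp (Primrec.of_equiv (e := equivProd)))

theorem primrec_z : Primrec z :=
  Primrec.snd.comp (Primrec.snd.comp (Primrec.of_equiv (e := equivProd)))

theorem primrec_mk {α : Type*} [Primcodable α] {f g h : α → ℤ} (hf : Primrec f) (hg : Primrec g)
    (hh : Primrec h) : Primrec fun x => (⟨f x, g x, h x⟩ : SymHeis) :=
  (Primrec.of_equiv_symm (e := equivProd)).comp (hf.pair (hg.pair hh))

theorem primrec_mul : Primrec₂ ((· * ·) : SymHeis → SymHeis → SymHeis) := by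
  have a₁ := primrec_a.comp (Primrec.fst (α := SymHeis) (β := SymHeis))
  have a₂ := primrec_a.comp (Primrec.snd (α := SymHeis) (β := SymHeis))
  have b₁ := primrec_b.comp (Primrec.fst (α := SymHeis) (β := SymHeis))
  have b₂ := primrec_b.comp (Primrec.snd (α := SymHeis) (β := SymHeis))
  exact primrec_mk (Primrec.int_add.comp a₁ a₂) (Primrec.int_add.comp b₁ b₂)
    (Primrec.int_add.comp
      (Primrec.int_add.comp (primrec_z.comp Primrec.fst) (primrec_z.comp Primrec.snd))
      (Primrec.int_sub.comp (Primrec.int_mul.comp a₁ b₂) (Primrec.int_mul.comp b₁ a₂)))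

/-! ### Primitive recursiveness of the bound -/

theorem _root_.Primrec.nat_pow_const {α : Type*} [Primcodable α] {f : α → ℕ} (hf : Primrec f)
    (n : ℕ) : Primrec fun x => f x ^ n := by
  induction n with
  | zero => simpa using Primrec.const 1
  | succ n ih => simpa only [pow_succ] using Primrec.nat_mul.comp ih hf

theorem primrec_blockBound_three : Primrec (blockBound 3) := by
  have add {f g : ℕ → ℕ} (hf : Primrec f) (hg : Primrec g) : Primrec fun n => f n + g n :=
    Primrec.nat_add.comp hf hg
  have mul {f g : ℕ → ℕ} (hf : Primrec f) (hg : Primrec g) : Primrec fun n => f n * g n :=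
    Primrec.nat_mul.comp hf hg
  have c (n : ℕ) : Primrec fun _ : ℕ => n := Primrec.const n
  have h₁ := add (mul (c 2) Primrec.id) (c 1)
  have h₂ := mul h₁ Primrec.id
  have h₃ := add (mul (c 2) h₂) (c 1)
  have h₄ := mul h₃ h₂
  have h₅ := add (mul (c 2) h₄) (c 1)
  exact (mul (mul h₅ h₃) h₁).of_eq fun M => (blockBound_three M).symm

theorem primrec_solutionBound : Primrec solutionBound := by
  have add {f g : ℕ → ℕ} (hf : Primrec f) (hg : Primrec g) : Primrec fun n => f n + g n :=
    Primrec.nat_add.comp hf hg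
  have mul {f g : ℕ → ℕ} (hf : Primrec f) (hg : Primrec g) : Primrec fun n => f n * g n :=
    Primrec.nat_mul.comp hf hg
  have pow {f : ℕ → ℕ} (hf : Primrec f) (k : ℕ) : Primrec fun n => f n ^ k := hf.nat_pow_const k
  have c (n : ℕ) : Primrec fun _ : ℕ => n := Primrec.const n
  have M : Primrec fun n : ℕ => n := Primrec.id
  have F := primrec_blockBound_three
  have Q := pow (mul (c 4) (pow M 2)) 3
  have C := add Q (mul (F.comp (mul (add (mul (c 2) Q) (c 1)) M)) Q)
  have Z {f : ℕ → ℕ} (hf : Primrec f) : Primrec fun n => f n * n + 2 * f n ^ 2 * n ^ 2 :=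
    add (mul hf M) (mul (mul (c 2) (pow hf 2)) (pow M 2))
  have k := mul (mul (c 2) (pow M 2)) (add (add (mul (c 2) (Z (add C (c 1))))
    (add (mul (c 2) M) (mul (c 2) (Z (mul (c 2) F))))) (c 2))
  have nonComm := add (mul (c 2) C) (mul k (add (mul (c 4) F) (c 4)))
  have R := add M (mul M F)
  have E := add (add (add M (mul (mul (c 2) M) F))
    (mul (mul (c 2) F) (add M (mul (mul (c 2) R) M)))) (mul (mul (c 4) R) M)
  have comm := add (mul (c 2) F) (F.comp E)
  exact add nonComm comm

/-! ### The decision procedure -/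

/-- All products `T * g₁ * ⋯ * gₖ` with `1 ≤ k ≤ n + 1` and `gᵢ ∈ g`. -/
def reach (n : ℕ) (T : SymHeis) (g : List SymHeis) : List SymHeis :=
  n.rec (g.map (T * ·)) fun _ L => L ++ L.flatMap fun x => g.map (x * ·)

theorem mem_reach {n : ℕ} {T : SymHeis} {g : List SymHeis} {x : SymHeis} :
    x ∈ reach n T g ↔
      ∃ w : List SymHeis, (∀ y ∈ w, y ∈ g) ∧ w ≠ [] ∧ w.length ≤ n + 1 ∧ T * w.prod = x := by
  induction n generalizing x with
  | zero =>
    change x ∈ g.map (T * ·) ↔ _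
    rw [List.mem_map]
    constructor
    · rintro ⟨y, hy, rfl⟩
      exact ⟨[y], by simpa using hy, by simp, by simp, by simp⟩
    · rintro ⟨w, hw, hw0, hl, rfl⟩
      obtain ⟨y, rfl⟩ := List.length_eq_one_iff.1
        (le_antisymm hl (List.length_pos_iff.2 hw0))
      exact ⟨y, hw y (by simp), by simp⟩
  | succ n ih =>
    have hstep : reach (n + 1) T g =
      reach n T g ++ (reach n T g).flatMap fun x => g.map (x * ·) := rfl
    rw [hstep, List.mem_append, List.mem_flatMap]
    constructor
    · rintro (h | ⟨y, hy, hx⟩)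
      · obtain ⟨w, h1, h2, h3, h4⟩ := ih.1 h
        exact ⟨w, h1, h2, by omega, h4⟩
      · obtain ⟨w, h1, h2, h3, rfl⟩ := ih.1 hy
        obtain ⟨s, hs, rfl⟩ := List.mem_map.1 hx
        refine ⟨w ++ [s], fun u hu => ?_, by simp, by simpa using h3, by simp [mul_assoc]⟩
        rcases List.mem_append.1 hu with hu | hu
        · exact h1 u hu
        · rwa [List.mem_singleton.1 hu]
    · rintro ⟨w, h1, h2, h3, rfl⟩
      by_cases hl : w.length ≤ n + 1
      · exact Or.inl (ih.2 ⟨w, h1, h2, hl, rfl⟩)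
      · obtain ⟨u, s, rfl⟩ := List.eq_nil_or_concat w |>.resolve_left h2
        simp only [List.concat_eq_append, List.length_append, List.length_singleton] at *
        refine Or.inr ⟨T * u.prod, ih.2 ⟨u, fun y hy => h1 y (by simp [hy]), ?_, by omega, rfl⟩, ?_⟩
        · rintro rfl
          simp at hl
        · exact List.mem_map.2 ⟨s, h1 s (by simp), by simp [mul_assoc]⟩

theorem primrec_reach {α : Type*} [Primcodable α] {f : α → ℕ} {T : α → SymHeis}
    {g : α → List SymHeis} (hf : Primrec f) (hT : Primrec T) (hg : Primrec g) :
    Primrec fun x => reach (f x) (T x) (g x) := by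
  have hL : Primrec fun p : α × ℕ × List SymHeis => p.2.2 := Primrec.snd.comp Primrec.snd
  have hstep : Primrec₂ fun (x : α) (p : ℕ × List SymHeis) =>
      p.2 ++ p.2.flatMap fun y => (g x).map (y * ·) := (Primrec.list_append.comp hL (Primrec.list_flatMap hL (Primrec.list_map
    (hg.comp (Primrec.fst.comp Primrec.fst))
    (primrec_mul.comp (Primrec.snd.comp Primrec.fst) Primrec.snd).to₂).to₂)).to₂
  exact Primrec.nat_rec' hf (Primrec.list_map hg
    (primrec_mul.comp (hT.comp Primrec.fst) Primrec.snd).to₂) hstep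

/-- Sum of the absolute values of the entries. -/
def size (x : SymHeis) : ℕ := x.a.natAbs + x.b.natAbs + x.z.natAbs

theorem bdd_of_size_le {x : SymHeis} {M : ℕ} (h : x.size ≤ M) : x.Bdd M := by
  unfold size at h
  refine ⟨?_, ?_, ?_⟩ <;> rw [Int.abs_eq_natAbs] <;> norm_cast <;> omega

theorem primrec_size : Primrec size :=
  Primrec.nat_add.comp (Primrec.nat_add.comp (Primrec.int_natAbs.comp primrec_a)
    (Primrec.int_natAbs.comp primrec_b)) (Primrec.int_natAbs.comp primrec_z)

end SymHeis

theorem Primrec.list_sum : Primrec (List.sum : List ℕ → ℕ) :=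
  (Primrec.list_foldr Primrec.id (Primrec.const 0)
    (Primrec.nat_add.comp (Primrec.fst.comp Primrec.snd)
      (Primrec.snd.comp Primrec.snd)).to₂).of_eq fun _ => rfl

theorem Primrec.list_prod : Primrec (List.prod : List ℕ → ℕ) :=
  (Primrec.list_foldr Primrec.id (Primrec.const 1)
    (Primrec.nat_mul.comp (Primrec.fst.comp Primrec.snd)
      (Primrec.snd.comp Primrec.snd)).to₂).of_eq fun _ => rfl

namespace HeisenbergCode

/-- The product of the three denominators. -/
def den (x : HeisenbergCode) : ℕ := x.1.2 * x.2.1.2 * x.2.2.2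

/-- The image in the integral group of the matrix with code `x` under the dilation
`(a, b, c) ↦ (d a, d b, d² c)`, if the denominators divide `d`. -/
def scale (d : ℕ) (x : HeisenbergCode) : SymHeis where
  a := x.1.1 * (d / x.1.2 : ℕ)
  b := x.2.1.1 * (d / x.2.1.2 : ℕ)
  z := 2 * (x.2.2.1 * (d / x.2.2.2 : ℕ) * d) -
    x.1.1 * (d / x.1.2 : ℕ) * (x.2.1.1 * (d / x.2.1.2 : ℕ))

theorem primrec_den : Primrec den :=
  Primrec.nat_mul.comp (Primrec.nat_mul.comp (Primrec.snd.comp Primrec.fst)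
    (Primrec.snd.comp (Primrec.fst.comp Primrec.snd)))
    (Primrec.snd.comp (Primrec.snd.comp Primrec.snd))

theorem primrec_scale : Primrec₂ scale := by
  have h (f : HeisenbergCode → RatCode) (hf : Primrec f) :
      Primrec fun p : ℕ × HeisenbergCode => (f p.2).1 * ((p.1 / (f p.2).2 : ℕ) : ℤ) :=
    Primrec.int_mul.comp (Primrec.fst.comp (hf.comp Primrec.snd))
      (Primrec.int_natCast.comp (Primrec.nat_div.comp Primrec.fst
        (Primrec.snd.comp (hf.comp Primrec.snd))))
  have ha := h (fun x => x.1) Primrec.fst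
  have hb := h (fun x => x.2.1) (Primrec.fst.comp Primrec.snd)
  have hc := h (fun x => x.2.2) (Primrec.snd.comp Primrec.snd)
  exact SymHeis.primrec_mk ha hb (Primrec.int_sub.comp (Primrec.int_mul.comp (Primrec.const 2)
    (Primrec.int_mul.comp hc (Primrec.int_natCast.comp Primrec.fst))) (Primrec.int_mul.comp ha hb))

end HeisenbergCode

/-- Inputs of the decision problem. -/
abbrev OrbitInput : Type :=
  HeisenbergCode × HeisenbergCode × List HeisenbergCode × List HeisenbergCode

namespace OrbitInput

/-- All codes occurring in the input. -/
def codes (p : OrbitInput) : List HeisenbergCode := p.1 :: p.2.1 :: (p.2.2.1 ++ p.2.2.2)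

/-- A common denominator of all entries. -/
def den (p : OrbitInput) : ℕ := (p.codes.map HeisenbergCode.den).prod

/-- A bound for the entries of all matrices after scaling to the integral group. -/
def entryBound (p : OrbitInput) : ℕ := (p.codes.map fun x => (x.scale p.den).size).sum

/-- The lengths of words up to which it suffices to search. -/
def searchBound (p : OrbitInput) : ℕ :=
  SymHeis.solutionBound (2 * (2 * p.entryBound + 2 * p.entryBound ^ 2) +
    2 * (2 * p.entryBound + 2 * p.entryBound ^ 2) ^ 2)

/-- Elements of the first orbit given by words up to the search bound. -/
def orbitT (p : OrbitInput) : List SymHeis :=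
  SymHeis.reach p.searchBound (p.1.scale p.den) (p.2.2.1.map (HeisenbergCode.scale p.den))

/-- Elements of the second orbit given by words up to the search bound. -/
def orbitS (p : OrbitInput) : List SymHeis :=
  SymHeis.reach p.searchBound (p.2.1.scale p.den) (p.2.2.2.map (HeisenbergCode.scale p.den))

theorem primrec_codes : Primrec codes :=
  Primrec.list_cons.comp Primrec.fst (Primrec.list_cons.comp (Primrec.fst.comp Primrec.snd)
    (Primrec.list_append.comp (Primrec.fst.comp (Primrec.snd.comp Primrec.snd))
      (Primrec.snd.comp (Primrec.snd.comp Primrec.snd))))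

theorem primrec_den : Primrec den :=
  Primrec.list_prod.comp
    (Primrec.list_map primrec_codes (HeisenbergCode.primrec_den.comp Primrec.snd).to₂)

theorem primrec_entryBound : Primrec entryBound :=
  Primrec.list_sum.comp (Primrec.list_map primrec_codes (SymHeis.primrec_size.comp
    (HeisenbergCode.primrec_scale.comp (primrec_den.comp Primrec.fst) Primrec.snd)).to₂)

theorem primrec_searchBound : Primrec searchBound := by
  have h : Primrec fun p : OrbitInput => 2 * p.entryBound + 2 * p.entryBound ^ 2 :=
    Primrec.nat_add.comp (Primrec.nat_mul.comp (Primrec.const 2) primrec_entryBound)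
      (Primrec.nat_mul.comp (Primrec.const 2) (primrec_entryBound.nat_pow_const 2))
  exact SymHeis.primrec_solutionBound.comp (Primrec.nat_add.comp
    (Primrec.nat_mul.comp (Primrec.const 2) h)
    (Primrec.nat_mul.comp (Primrec.const 2) (h.nat_pow_const 2)))

theorem primrec_map_scale {f : OrbitInput → List HeisenbergCode} (hf : Primrec f) :
    Primrec fun p : OrbitInput => (f p).map (HeisenbergCode.scale p.den) :=
  Primrec.list_map hf
    (HeisenbergCode.primrec_scale.comp (primrec_den.comp Primrec.fst) Primrec.snd).to₂

theorem primrec_orbitT : Primrec orbitT :=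
  SymHeis.primrec_reach primrec_searchBound
    (HeisenbergCode.primrec_scale.comp primrec_den Primrec.fst)
    (primrec_map_scale (Primrec.fst.comp (Primrec.snd.comp Primrec.snd)))

theorem primrec_orbitS : Primrec orbitS :=
  SymHeis.primrec_reach primrec_searchBound
    (HeisenbergCode.primrec_scale.comp primrec_den (Primrec.fst.comp Primrec.snd))
    (primrec_map_scale (Primrec.snd.comp (Primrec.snd.comp Primrec.snd)))

theorem primrecPred_disjoint :
    PrimrecPred fun p : OrbitInput => ¬ ∃ x ∈ p.orbitT, ∃ y ∈ p.orbitS, y = x := by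
  have h : PrimrecRel fun (x : SymHeis) (L : List SymHeis) => ∃ y ∈ L, y = x :=
    (Primrec.eq (α := SymHeis)).exists_mem_list.comp Primrec.snd Primrec.fst
  exact (h.exists_mem_list.comp primrec_orbitT primrec_orbitS).not

end OrbitInput

/-! ### Transfer to rational matrices -/

/-- `x` is the image of the matrix `A` in symmetric coordinates under the dilation by `d`. -/
def IsScaled (d : ℕ) (A : Heisenberg3 ℚ) (x : SymHeis) : Prop :=
  ∃ a b c : ℚ, (A.1 : Matrix (Fin 3) (Fin 3) ℚ) = !![1, a, c; 0, 1, b; 0, 0, 1] ∧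
    (x.a : ℚ) = d * a ∧ (x.b : ℚ) = d * b ∧ (x.z : ℚ) = d ^ 2 * (2 * c - a * b)

theorem IsScaled.mul {d : ℕ} {A B : Heisenberg3 ℚ} {x y : SymHeis} (hA : IsScaled d A x)
    (hB : IsScaled d B y) : IsScaled d (A * B) (x * y) := by
  obtain ⟨a, b, c, hA, h1, h2, h3⟩ := hA
  obtain ⟨a', b', c', hB, h1', h2', h3'⟩ := hB
  refine ⟨a + a', b + b', c' + a * b' + c, ?_, ?_, ?_, ?_⟩
  · rw [Subgroup.coe_mul, Matrix.SpecialLinearGroup.coe_mul, hA, hB]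
    ext i j; fin_cases i <;> fin_cases j <;> simp [Matrix.mul_apply, Fin.sum_univ_three, add_comm]
  · rw [SymHeis.mul_a]; push_cast; rw [h1, h1']; ring
  · rw [SymHeis.mul_b]; push_cast; rw [h2, h2']; ring
  · rw [SymHeis.mul_z]; push_cast; rw [h1, h1', h2, h2', h3, h3']; ring

theorem IsScaled.eq_iff {d : ℕ} (hd : d ≠ 0) {A B : Heisenberg3 ℚ} {x y : SymHeis}
    (hA : IsScaled d A x) (hB : IsScaled d B y) : A = B ↔ x = y := by
  obtain ⟨a, b, c, hA, h1, h2, h3⟩ := hA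
  obtain ⟨a', b', c', hB, h1', h2', h3'⟩ := hB
  have hd' : (d : ℚ) ≠ 0 := by exact_mod_cast hd
  constructor
  · rintro rfl
    have h := hA.symm.trans hB
    obtain rfl : a = a' := by simpa using congrFun (congrFun h 0) 1
    obtain rfl : b = b' := by simpa using congrFun (congrFun h 1) 2
    obtain rfl : c = c' := by simpa using congrFun (congrFun h 0) 2
    ext
    · exact_mod_cast h1.trans h1'.symm
    · exact_mod_cast h2.trans h2'.symm
    · exact_mod_cast h3.trans h3'.symm
  · rintro rfl
    obtain rfl : a = a' := mul_left_cancel₀ hd' (h1.symm.trans h1')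
    obtain rfl : b = b' := mul_left_cancel₀ hd' (h2.symm.trans h2')
    obtain rfl : c = c' := by
      have := mul_left_cancel₀ (pow_ne_zero 2 hd') (h3.symm.trans h3')
      linarith
    exact Subtype.ext (Subtype.ext (hA.trans hB.symm))

theorem RatCode.Encodes.mul_div {x : RatCode} {q : ℚ} (h : x.Encodes q) {d : ℕ} (hd : x.2 ∣ d) :
    ((x.1 * (d / x.2 : ℕ) : ℤ) : ℚ) = d * q := by
  obtain ⟨h0, rfl⟩ := h
  have h0' : (x.2 : ℚ) ≠ 0 := by exact_mod_cast h0
  rw [Int.cast_mul, Int.cast_natCast, Nat.cast_div hd h0']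
  field_simp

theorem HeisenbergCode.Encodes.isScaled {x : HeisenbergCode} {A : Heisenberg3 ℚ} (h : x.Encodes A)
    {d : ℕ} (hd : x.den ∣ d) : IsScaled d A (x.scale d) := by
  obtain ⟨a, b, c, ha, hb, hc, hA⟩ := h
  have ha' := ha.mul_div (((Dvd.intro _ rfl).trans (Dvd.intro _ rfl)).trans hd)
  have hb' := hb.mul_div (((Dvd.intro_left _ rfl).trans (Dvd.intro _ rfl)).trans hd)
  have hc' := hc.mul_div ((Dvd.intro_left _ rfl).trans hd)
  refine ⟨a, b, c, hA, ha', hb', ?_⟩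
  simp only [HeisenbergCode.scale]
  rw [Int.cast_sub, Int.cast_mul (_ * _) (_ * _), ha', hb', Int.cast_mul, Int.cast_mul, hc']
  push_cast
  ring

theorem HeisenbergCode.Encodes.den_ne_zero {x : HeisenbergCode} {A : Heisenberg3 ℚ}
    (h : x.Encodes A) : x.den ≠ 0 := by
  obtain ⟨a, b, c, ha, hb, hc, -⟩ := h
  exact mul_ne_zero (mul_ne_zero ha.1 hb.1) hc.1

/-- The semigroup generated by `𝒢` corresponds to the products of nonempty words in the scaled
generators. -/
theorem exists_word_of_mem_closure {d : ℕ} {𝒢 : Finset (Heisenberg3 ℚ)} {g : List HeisenbergCode}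
    (hg : EncodesFinset g 𝒢) (hd : ∀ x ∈ g, x.den ∣ d) {A : Heisenberg3 ℚ}
    (hA : A ∈ Subsemigroup.closure (𝒢 : Set (Heisenberg3 ℚ))) :
    ∃ w : List SymHeis, (∀ y ∈ w, y ∈ g.map (HeisenbergCode.scale d)) ∧ w ≠ [] ∧
      IsScaled d A w.prod := by
  induction hA using Subsemigroup.closure_induction with
  | mem A hA =>
    obtain ⟨x, hx, hxA⟩ := hg.2 A hA
    exact ⟨[x.scale d], by simpa using List.mem_map.2 ⟨x, hx, rfl⟩, by simp, by
      simpa using hxA.isScaled (hd x hx)⟩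
  | mul A B _ _ ihA ihB =>
    obtain ⟨w, h1, h2, h3⟩ := ihA
    obtain ⟨v, k1, k2, k3⟩ := ihB
    exact ⟨w ++ v, fun y hy => (List.mem_append.1 hy).elim (h1 y) (k1 y), by simp [h2],
      by rw [List.prod_append]; exact h3.mul k3⟩

theorem exists_mem_closure_of_word {d : ℕ} {𝒢 : Finset (Heisenberg3 ℚ)} {g : List HeisenbergCode}
    (hg : EncodesFinset g 𝒢) (hd : ∀ x ∈ g, x.den ∣ d) {w : List SymHeis}
    (hw : ∀ y ∈ w, y ∈ g.map (HeisenbergCode.scale d)) (hw0 : w ≠ []) :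
    ∃ A ∈ Subsemigroup.closure (𝒢 : Set (Heisenberg3 ℚ)), IsScaled d A w.prod := by
  induction w with
  | nil => exact absurd rfl hw0
  | cons y w ih =>
    obtain ⟨x, hx, rfl⟩ := List.mem_map.1 (hw y List.mem_cons_self)
    obtain ⟨A, hA, hxA⟩ := hg.1 x hx
    have hA' := hxA.isScaled (hd x hx)
    by_cases h0 : w = []
    · subst h0
      exact ⟨A, Subsemigroup.subset_closure hA, by simpa using hA'⟩
    · obtain ⟨B, hB, hB'⟩ := ih (fun y hy => hw y (List.mem_cons_of_mem _ hy)) h0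
      exact ⟨A * B, mul_mem (Subsemigroup.subset_closure hA) hB, by
        rw [List.prod_cons]; exact hA'.mul hB'⟩

/-- Correctness of the bounded search. -/
theorem exists_mem_orbits_iff {T S : Heisenberg3 ℚ} {𝒢 ℋ : Finset (Heisenberg3 ℚ)}
    {p : OrbitInput} (hT : p.1.Encodes T) (hS : p.2.1.Encodes S) (h𝒢 : EncodesFinset p.2.2.1 𝒢)
    (hℋ : EncodesFinset p.2.2.2 ℋ) :
    (∃ x ∈ p.orbitT, ∃ y ∈ p.orbitS, y = x) ↔
      (semigroupOrbit T (𝒢 : Set (Heisenberg3 ℚ)) ∩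
        semigroupOrbit S (ℋ : Set (Heisenberg3 ℚ))).Nonempty := by
  have hdvd : ∀ x ∈ p.codes, x.den ∣ p.den := fun x hx =>
    List.dvd_prod (List.mem_map.2 ⟨x, hx, rfl⟩)
  have hd0 : p.den ≠ 0 := by
    refine List.prod_ne_zero fun h => ?_
    obtain ⟨x, hx, hx0⟩ := List.mem_map.1 h
    have : ∃ A, x.Encodes A := by
      simp only [OrbitInput.codes, List.mem_cons, List.mem_append] at hx
      rcases hx with rfl | rfl | hx | hx
      · exact ⟨T, hT⟩
      · exact ⟨S, hS⟩
      · obtain ⟨A, -, hA⟩ := h𝒢.1 x hx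
        exact ⟨A, hA⟩
      · obtain ⟨A, -, hA⟩ := hℋ.1 x hx
        exact ⟨A, hA⟩
    obtain ⟨A, hA⟩ := this
    exact hA.den_ne_zero hx0
  have hbdd : ∀ x ∈ p.codes, (x.scale p.den).Bdd p.entryBound := fun x hx =>
    SymHeis.bdd_of_size_le (List.single_le_sum (fun _ _ => Nat.zero_le _) _
      (List.mem_map.2 ⟨x, hx, rfl⟩))
  have mT : p.1 ∈ p.codes := by simp [OrbitInput.codes]
  have mS : p.2.1 ∈ p.codes := by simp [OrbitInput.codes]
  have mG : ∀ x ∈ p.2.2.1, x ∈ p.codes := fun x hx => by simp [OrbitInput.codes, hx]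
  have mH : ∀ x ∈ p.2.2.2, x ∈ p.codes := fun x hx => by simp [OrbitInput.codes, hx]
  have hT' := hT.isScaled (hdvd _ mT)
  have hS' := hS.isScaled (hdvd _ mS)
  have dG : ∀ x ∈ p.2.2.1, x.den ∣ p.den := fun x hx => hdvd x (mG x hx)
  have dH : ∀ x ∈ p.2.2.2, x.den ∣ p.den := fun x hx => hdvd x (mH x hx)
  constructor
  · rintro ⟨x, hx, y, hy, rfl⟩
    obtain ⟨w, hw, hw0, -, hwx⟩ := SymHeis.mem_reach.1 hx
    obtain ⟨v, hv, hv0, -, hvx⟩ := SymHeis.mem_reach.1 hy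
    obtain ⟨A, hA, hA'⟩ := exists_mem_closure_of_word h𝒢 dG hw hw0
    obtain ⟨B, hB, hB'⟩ := exists_mem_closure_of_word hℋ dH hv hv0
    refine ⟨T * A, ⟨A, hA, rfl⟩, B, hB, ?_⟩
    exact ((hT'.mul hA').eq_iff hd0 (hS'.mul hB')).2 (hwx.trans hvx.symm)
  · rintro ⟨_, ⟨A, hA, rfl⟩, B, hB, hAB⟩
    obtain ⟨w, hw, hw0, hA'⟩ := exists_word_of_mem_closure h𝒢 dG hA
    obtain ⟨v, hv, hv0, hB'⟩ := exists_word_of_mem_closure hℋ dH hB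
    have heq := ((hT'.mul hA').eq_iff hd0 (hS'.mul hB')).1 hAB
    obtain ⟨w', v', h1, h2, h3, h4, h5, h6, h7⟩ := SymHeis.exists_short_orbit_solution
      (G := {y | y ∈ p.2.2.1.map (HeisenbergCode.scale p.den)})
      (H := {y | y ∈ p.2.2.2.map (HeisenbergCode.scale p.den)}) (M := p.entryBound)
      (by
        intro y hy
        obtain ⟨x, hx, rfl⟩ := List.mem_map.1 hy
        exact hbdd x (mG x hx))
      (by
        intro y hy
        obtain ⟨x, hx, rfl⟩ := List.mem_map.1 hy
        exact hbdd x (mH x hx)) (hbdd _ mT) (hbdd _ mS) hw hv hw0 hv0 heq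
      (B := p.searchBound) le_rfl
    exact ⟨_, SymHeis.mem_reach.2 ⟨w', h1, h3, h6, h5⟩, _, SymHeis.mem_reach.2
      ⟨v', h2, h4, h7, rfl⟩, rfl⟩

/-- There is a single algorithm (a computable Boolean function) which, given codes of `T`, `S`,
`𝒢`, `ℋ`, decides whether the orbits `T · ⟨𝒢⟩` and `S · ⟨ℋ⟩` are disjoint. -/
theorem theorem2 :
    ∃ D : HeisenbergCode × HeisenbergCode × List HeisenbergCode × List HeisenbergCode → Bool,
      Computable D ∧
      ∀ (T S : Heisenberg3 ℚ) (𝒢 ℋ : Finset (Heisenberg3 ℚ))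
        (t s : HeisenbergCode) (g h : List HeisenbergCode),
        t.Encodes T → s.Encodes S → EncodesFinset g 𝒢 → EncodesFinset h ℋ →
        (D (t, s, g, h) = true ↔
          semigroupOrbit T (𝒢 : Set (Heisenberg3 ℚ)) ∩
            semigroupOrbit S (ℋ : Set (Heisenberg3 ℚ)) = ∅) := by
  obtain ⟨inst, hD⟩ := OrbitInput.primrecPred_disjoint
  refine ⟨_, hD.to_comp, fun T S 𝒢 ℋ t s g h hT hS h𝒢 hℋ => ?_⟩
  rw [decide_eq_true_iff]
  beta_reduce
  rw [exists_mem_orbits_iff (p := (t, s, g, h)) hT hS h𝒢 hℋ,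
    Set.not_nonempty_iff_eq_empty]
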